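/- Let $G$ be a graph and $X,Y\subseteq V(G)$. An $X$-$Y$-path is a path with one endpoint in $X$ and the opposite endpoint in $Y$ (a single vertex of $X\cap Y$ is allowed). Paths are disjoint if they share no vertex, and two paths are non-adjacent if they are disjoint and no edge of $G$ joins a vertex of one to a vertex of the other. For a collection $\mathcal P$ of paths, $V(\mathcal P)$ and $E(\mathcal P)$ denote the unions of their vertex sets and of their edge sets. **Theorem.** If $G$ is a graph, $X,Y\subseteq V(G)$, and there exists a collection $\mathcal P$ of five pairwise disjoint $X$-$Y$-paths such that every vertex in $V(\mathcal P)$ is incident to at most one edge in $E(G)\setminus E(\mathcal P)$, then there exist two non-adjacent $X$-$Y$-paths in $G$. Furthermore, the statement does not necessarily hold if either (a) $\mathcal P$ contains four paths instead of five: there exist a finite graph $G$, sets $X,Y\subseteq V(G)$ and a collection $\mathcal P$ of four pairwise disjoint $X$-$Y$-paths such that every vertex in $V(\mathcal P)$ is incident to at most one edge in $E(G)\setminus E(\mathcal P)$, but $G$ has no two non-adjacent $X$-$Y$-paths; or (b) the condition that every vertex in $V(\mathcal P)$ is incident to at most one edge in $E(G)\setminus E(\mathcal P)$ is replaced by the condition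 that $G$ has maximum degree three: there exist a finite graph $G$ of maximum degree $3$, sets $X,Y\subseteq V(G)$ and a collection of five pairwise disjoint $X$-$Y$-paths in $G$, but $G$ has no two non-adjacent $X$-$Y$-paths. -/

import Mathlib

namespace SimpleGraph

/-- An `X`-`Y`-path of `G`: a path with one endpoint in `X` and the opposite endpoint in `Y`.
A single vertex of `X ∩ Y` counts as a path of length `0`; inner vertices are unrestricted.
The path is written so that it starts at its endpoint in `X`. -/
structure XYPath {V : Type*} (G : SimpleGraph V) (X Y : Set V) where
  source : V
  target : V
  source_mem : source ∈ X
  target_mem : target ∈ Y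
  walk : G.Walk source target
  isPath : walk.IsPath

namespace XYPath

variable {V : Type*} {G : SimpleGraph V} {X Y : Set V}

/-- The vertex set of a path. -/
def verts (P : XYPath G X Y) : Set V := {v | v ∈ P.walk.support}

/-- The edge set of a path. -/
def edges (P : XYPath G X Y) : Set (Sym2 V) := {e | e ∈ P.walk.edges}

/-- Non-adjacent paths: they share no vertex, and no edge of `G` joins a vertex of one to a
vertex of the other. -/
def NonAdjacent (P Q : XYPath G X Y) : Prop :=
  Disjoint P.verts Q.verts ∧ ∀ u ∈ P.verts, ∀ v ∈ Q.verts, ¬ G.Adj u v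

/-- The paths of the family share no vertices pairwise. -/
def PairwiseDisjoint {ι : Type*} (𝓟 : ι → XYPath G X Y) : Prop :=
  Pairwise fun i j => Disjoint (𝓟 i).verts (𝓟 j).verts

/-- Every vertex on a path of the family is incident to at most one edge of `G` that is on
none of the paths. -/
def AtMostOneEdgeOff {ι : Type*} (𝓟 : ι → XYPath G X Y) : Prop :=
  ∀ v ∈ ⋃ i, (𝓟 i).verts, (G.incidenceSet v \ ⋃ i, (𝓟 i).edges).encard ≤ 1

end XYPath

end SimpleGraph

/-!
Given five disjoint paths whose vertices have at most one further edge each, call the paths lines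
and the further edges between vertices of the lines rungs. Only the subgraph induced on the lines
matters: it consists of the lines and a matching of rungs. Among all such families of five lines in
`G`, take one with the least number of edges (`Linkage.IsMinimal`). Rerouting the lines along rungs
(`Linkage.Detour`) gives families of the same kind, so minimality limits the possible rungs: none is
a chord of a line, and if the next vertices on some lines `k` are joined to vertices on lines `σ k`
further up, then these are the vertices directly after the next ones.

Consequently the lines can be swept from `X` to `Y` such that the part swept over is always closed
under rungs and each step has one of three forms (`Linkage.IsMinimal.exists_next`): pass a vertex
without rung, pass both ends of a rung between the current fronts of two lines, or pass two vertices
on each line moved by a permutation `σ`, the first of them on line `k` being joined to the second on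
line `σ k`. During the sweep, pairs of non-adjacent partial paths are extended. For a further
extension only the following matters (`Linkage.Realized`): the lines on which the two partial paths
end, and for every other line whether its last vertex is on one of them, since the next vertex of
that line is then forbidden for the other. The lemmas `Linkage.Realized.clear`,
`Linkage.Realized.rung` and `Linkage.Realized.block` describe extensions in the three kinds of
steps.

This is a finite automaton. Its states are families of configurations that are all realized, up to
renaming the lines. A computer search found a list of 13 nonempty families (`stateTable`) such that
from each of them every possible step leads to another one; the kernel verifies this in
`rung_certified` and `block_certified`. Since before the first step every configuration is realized,
some configuration is still realized at the end, and this is a pair of non-adjacent paths.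

With four lines the automaton can get stuck, which yields a graph of four lines with eight vertices
each and 16 rungs. That it has no two non-adjacent paths is verified by following every path from
the bottom until its closed neighbourhood separates the bottom from the top, which always happens
before or when it reaches the top (`ladderSearch_sound`). For maximum degree three, the Petersen
graph, with the outer and the inner five-cycle as `X` and `Y`, is an example: every path between
them contains a spoke, and any two spokes are adjacent.
-/

namespace SimpleGraph

/-! ### Families of lines in coordinates -/

/-- Two positions `(line, height)` are consecutive on a common line. -/
def Consec {ι : Type*} (p q : ι × ℕ) : Prop :=
  p.1 = q.1 ∧ (p.2 + 1 = q.2 ∨ q.2 + 1 = p.2)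

/-- A family of disjoint `X`-`Y`-paths ("lines") indexed by `ι`, in coordinates: `vert (i, a)` is
the `a`-th vertex of line `i`, for `a ≤ len i`; the values of `vert` beyond that are irrelevant.
Every vertex of the family has at most one neighbour in the family that is neither its predecessor
nor its successor. -/
structure Linkage {V : Type*} (G : SimpleGraph V) (X Y : Set V) (ι : Type*) where
  len : ι → ℕ
  vert : ι × ℕ → V
  inj : ∀ p q : ι × ℕ, p.2 ≤ len p.1 → q.2 ≤ len q.1 → vert p = vert q → p = q
  adj : ∀ i a, a < len i → G.Adj (vert (i, a)) (vert (i, a + 1))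
  start_mem : ∀ i, vert (i, 0) ∈ X
  end_mem : ∀ i, vert (i, len i) ∈ Y
  off_unique : ∀ p q r : ι × ℕ, p.2 ≤ len p.1 → q.2 ≤ len q.1 → r.2 ≤ len r.1 →
    G.Adj (vert p) (vert q) → ¬ Consec p q → G.Adj (vert p) (vert r) → ¬ Consec p r → q = r

namespace Linkage

variable {V : Type*} {G : SimpleGraph V} {X Y : Set V} {ι : Type*}

/-- Two positions of the family are joined by an edge of `G` that is on none of the lines. -/
def Off (L : Linkage G X Y ι) (p q : ι × ℕ) : Prop :=
  p.2 ≤ L.len p.1 ∧ q.2 ≤ L.len q.1 ∧ G.Adj (L.vert p) (L.vert q) ∧ ¬ Consec p q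

lemma Off.symm {L : Linkage G X Y ι} {p q : ι × ℕ} (h : L.Off p q) : L.Off q p :=
  ⟨h.2.1, h.1, h.2.2.1.symm, fun h' => h.2.2.2 ⟨h'.1.symm, h'.2.symm⟩⟩

lemma Off.unique {L : Linkage G X Y ι} {p q r : ι × ℕ} (h : L.Off p q) (h' : L.Off p r) : q = r :=
  L.off_unique p q r h.1 h.2.1 h'.2.1 h.2.2.1 h.2.2.2 h'.2.2.1 h'.2.2.2

lemma adj_of_consec (L : Linkage G X Y ι) {p q : ι × ℕ} (hp : p.2 ≤ L.len p.1)
    (hq : q.2 ≤ L.len q.1) (h : Consec p q) : G.Adj (L.vert p) (L.vert q) := by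
  obtain ⟨i, a⟩ := p
  obtain ⟨j, b⟩ := q
  obtain ⟨rfl, h | h⟩ := h
  · simp only at h hp hq; subst h; exact L.adj i a hq
  · simp only at h hp hq; subst h; exact (L.adj i b hp).symm

/-- The family has the least number of edges among all families of this kind. -/
def IsMinimal [Fintype ι] (L : Linkage G X Y ι) : Prop :=
  ∀ L' : Linkage G X Y ι, ∑ i, L.len i ≤ ∑ i, L'.len i

/-! ### Rerouting -/

/-- Data for rerouting a family along off-path edges: each line `i` in `J` is followed up to height
`s i` and then left along an off-path edge to height `t i` of line `σ i`, which lies above the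
height at which that line is left. The case `σ i = i` is a shortcut along a chord. -/
structure Detour (L : Linkage G X Y ι) where
  J : Set ι
  σ : Equiv.Perm ι
  s : ι → ℕ
  t : ι → ℕ
  fix : ∀ i, i ∉ J → σ i = i
  lt : ∀ i ∈ J, s (σ i) < t i
  off : ∀ i ∈ J, L.Off (i, s i) (σ i, t i)

namespace Detour

variable {L : Linkage G X Y ι} (D : Detour L)

lemma map_mem {i : ι} (hi : i ∈ D.J) : D.σ i ∈ D.J := by
  by_contra h
  have h1 := D.fix _ h
  have h2 := D.σ.injective h1
  rw [h2] at h
  exact h hi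

open Classical in
/-- The number of edges of the rerouted line `i`. -/
noncomputable def len (i : ι) : ℕ :=
  if i ∈ D.J then D.s i + 1 + (L.len (D.σ i) - D.t i) else L.len i

open Classical in
/-- The position in the old family of a position of the rerouted family. -/
noncomputable def pos (p : ι × ℕ) : ι × ℕ :=
  if p.1 ∈ D.J then
    if p.2 ≤ D.s p.1 then p else (D.σ p.1, D.t p.1 + (p.2 - D.s p.1 - 1))
  else p

lemma pos_cases (p : ι × ℕ) (hp : p.2 ≤ D.len p.1) :
    (p.1 ∉ D.J ∧ D.pos p = p ∧ p.2 ≤ L.len p.1) ∨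
    (p.1 ∈ D.J ∧ p.2 ≤ D.s p.1 ∧ D.pos p = p ∧ p.2 ≤ L.len p.1) ∨
    (p.1 ∈ D.J ∧ ∃ k, p.2 = D.s p.1 + 1 + k ∧ D.pos p = (D.σ p.1, D.t p.1 + k) ∧
      D.t p.1 + k ≤ L.len (D.σ p.1)) := by
  by_cases h : p.1 ∈ D.J
  · have ho := D.off _ h
    by_cases h' : p.2 ≤ D.s p.1
    · refine Or.inr (Or.inl ⟨h, h', by simp [pos, h, h'], h'.trans ho.1⟩)
    · refine Or.inr (Or.inr ⟨h, p.2 - D.s p.1 - 1, by omega, by simp [pos, h, h'], ?_⟩)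
      have h1 := ho.2.1
      simp only [len, h, if_true] at hp
      simp only at h1
      omega
  · refine Or.inl ⟨h, by simp [pos, h], ?_⟩
    simpa [len, h] using hp

lemma pos_valid (p : ι × ℕ) (hp : p.2 ≤ D.len p.1) : (D.pos p).2 ≤ L.len (D.pos p).1 := by
  rcases D.pos_cases p hp with ⟨-, h, h'⟩ | ⟨-, -, h, h'⟩ | ⟨-, k, -, h, h'⟩ <;> rw [h] <;> exact h'

lemma pos_inj (p q : ι × ℕ) (hp : p.2 ≤ D.len p.1) (hq : q.2 ≤ D.len q.1)
    (h : D.pos p = D.pos q) : p = q := by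
  have key : ∀ i k, i ∈ D.J → ∀ p : ι × ℕ, (p.1 ∈ D.J → p.2 ≤ D.s p.1) →
      p ≠ (D.σ i, D.t i + k) := by
    rintro i k hi p hp rfl
    have := hp (D.map_mem hi)
    have := D.lt i hi
    simp only at *
    omega
  rcases D.pos_cases p hp with ⟨h1, h2, -⟩ | ⟨h1, h1', h2, -⟩ | ⟨h1, k, h1', h2, -⟩ <;>
  rcases D.pos_cases q hq with ⟨g1, g2, -⟩ | ⟨g1, g1', g2, -⟩ | ⟨g1, l, g1', g2, -⟩ <;>
  rw [h2, g2] at h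
  · exact h
  · exact h
  · exact absurd h (key _ _ g1 _ fun h' => absurd h' h1)
  · exact h
  · exact h
  · exact absurd h (key _ _ g1 _ fun _ => h1')
  · exact absurd h.symm (key _ _ h1 _ fun h' => absurd h' g1)
  · exact absurd h.symm (key _ _ h1 _ fun _ => g1')
  · rw [Prod.mk.injEq] at h
    have h3 := D.σ.injective h.1
    ext
    · exact h3
    · rw [h3] at h h1'; omega

/-- If two positions `p`, `q` of the rerouted family that are not consecutive there
were consecutive before, then they are, in some order, the vertices just below and just above a
cut of an old line, and `p` has a new neighbour along an off-path edge. -/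
lemma cut_of_consec (p q : ι × ℕ) (hp : p.2 ≤ D.len p.1) (hq : q.2 ≤ D.len q.1)
    (h : Consec (D.pos p) (D.pos q)) (hn : ¬ Consec p q) :
    (∃ i, D.pos p = (i, D.s i) ∧ D.pos q = (i, D.s i + 1) ∧
      ∃ r : ι × ℕ, r.2 ≤ D.len r.1 ∧ Consec p r ∧ L.Off (D.pos p) (D.pos r)) ∨
    (∃ i, D.pos p = (i, D.s i + 1) ∧ D.pos q = (i, D.s i) ∧
      ∃ r : ι × ℕ, r.2 ≤ D.len r.1 ∧ Consec p r ∧ L.Off (D.pos p) (D.pos r)) := by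
  obtain ⟨h0, h⟩ := h
  rcases D.pos_cases p hp with ⟨h1, h2, -⟩ | ⟨h1, h1', h2, -⟩ | ⟨h1, k, h1', h2, h3⟩ <;>
  rcases D.pos_cases q hq with ⟨g1, g2, -⟩ | ⟨g1, g1', g2, -⟩ | ⟨g1, l, g1', g2, g3⟩ <;>
  rw [h2, g2] at h h0 <;> try simp only at h h0
  · exact absurd ⟨h0, h⟩ hn
  · exact absurd ⟨h0, h⟩ hn
  · rw [h0] at h1; exact absurd (D.map_mem g1) h1
  · exact absurd ⟨h0, h⟩ hn
  · exact absurd ⟨h0, h⟩ hn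
  · have hlt := D.lt _ g1
    rw [← h0] at hlt
    refine Or.inl ⟨p.1, ?_, ?_, (p.1, D.s p.1 + 1), ?_, ⟨rfl, Or.inl ?_⟩, ?_⟩
    · rw [h2]; ext; · rfl
      simp only; omega
    · rw [g2, ← h0]; ext; · rfl
      simp only; omega
    · simp [len, h1]
    · simp only; omega
    · have : D.pos (p.1, D.s p.1 + 1) = (D.σ p.1, D.t p.1) := by simp [pos, h1]
      rw [this, h2]
      have hp' : p = (p.1, D.s p.1) := by
        ext; · rfl
        simp only; omega
      rw [hp']; exact D.off _ h1
  · rw [← h0] at g1; exact absurd (D.map_mem h1) g1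
  · have hlt := D.lt _ h1
    rw [h0] at hlt
    refine Or.inr ⟨q.1, ?_, ?_, (p.1, D.s p.1), ?_, ⟨rfl, Or.inr ?_⟩, ?_⟩
    · rw [h2, h0]; ext; · rfl
      simp only; omega
    · rw [g2]; ext; · rfl
      simp only; omega
    · simp only [len, h1, if_true]; omega
    · simp only; omega
    · have : D.pos (p.1, D.s p.1) = (p.1, D.s p.1) := by simp [pos]
      rw [this, h2]
      have hk : k = 0 := by omega
      subst hk
      exact (D.off _ h1).symm
  · have h4 := D.σ.injective h0
    refine absurd ⟨h4, ?_⟩ hn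
    rw [h4] at h1' h
    omega

/-- The rerouted family. A vertex where a line was cut trades its old successor or predecessor for
its only off-path neighbour, so it still has at most one off-path neighbour. -/
noncomputable def reroute : Linkage G X Y ι where
  len := D.len
  vert p := L.vert (D.pos p)
  inj p q hp hq h := D.pos_inj p q hp hq
    (L.inj _ _ (D.pos_valid p hp) (D.pos_valid q hq) h)
  adj i a ha := by
    have hc : Consec (D.pos (i, a)) (D.pos (i, a + 1)) ∨
        L.Off (D.pos (i, a)) (D.pos (i, a + 1)) := by
      by_cases h : i ∈ D.J
      · rcases lt_trichotomy a (D.s i) with h' | h' | h'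
        · left
          have h1 : a ≤ D.s i := h'.le
          have h2 : a + 1 ≤ D.s i := h'
          simp [pos, h, h1, h2, Consec]
        · right
          subst h'
          simpa [pos, h] using D.off i h
        · left
          have h1 : ¬ a ≤ D.s i := not_le.2 h'
          have h2 : ¬ a + 1 ≤ D.s i := by omega
          simp only [pos, h, h1, h2, if_true, if_false, Consec, true_and]
          omega
      · left
        simp [pos, h, Consec]
    rcases hc with hc | hc
    · exact L.adj_of_consec (D.pos_valid _ ha.le) (D.pos_valid _ ha) hc
    · exact hc.2.2.1
  start_mem i := by
    have : D.pos (i, 0) = (i, 0) := by simp [pos]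
    rw [this]; exact L.start_mem i
  end_mem i := by
    by_cases h : i ∈ D.J
    · have h1 := (D.off i h).2.1
      simp only at h1
      have : D.pos (i, D.len i) = (D.σ i, L.len (D.σ i)) := by
        have h2 : ¬ D.s i + 1 + (L.len (D.σ i) - D.t i) ≤ D.s i := by omega
        simp only [pos, len, h, if_true, h2, if_false]
        ext
        · rfl
        · simp only; omega
      rw [this]; exact L.end_mem _
    · have : D.pos (i, D.len i) = (i, L.len i) := by simp [pos, len, h]
      rw [this]; exact L.end_mem _
  off_unique p q r hp hq hr hpq npq hpr npr := by
    have vp := D.pos_valid p hp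
    have vq := D.pos_valid q hq
    have vr := D.pos_valid r hr
    apply D.pos_inj q r hq hr
    by_cases cq : Consec (D.pos p) (D.pos q) <;> by_cases cr : Consec (D.pos p) (D.pos r)
    · rcases D.cut_of_consec p q hp hq cq npq with ⟨i, h1, h2, -⟩ | ⟨i, h1, h2, -⟩ <;>
      rcases D.cut_of_consec p r hp hr cr npr with ⟨j, g1, g2, -⟩ | ⟨j, g1, g2, -⟩ <;>
      rw [h2, g2] <;> rw [h1, Prod.mk.injEq] at g1 <;> obtain ⟨rfl, g1⟩ := g1
      · rfl
      · omega
      · omega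
      · rfl
    · exfalso
      have hr' : L.Off (D.pos p) (D.pos r) := ⟨vp, vr, hpr, cr⟩
      rcases D.cut_of_consec p q hp hq cq npq with ⟨-, -, -, x, hx, hc, ho⟩ |
        ⟨-, -, -, x, hx, hc, ho⟩ <;>
      exact npr (D.pos_inj _ _ hr hx (hr'.unique ho) ▸ hc)
    · exfalso
      have hq' : L.Off (D.pos p) (D.pos q) := ⟨vp, vq, hpq, cq⟩
      rcases D.cut_of_consec p r hp hr cr npr with ⟨-, -, -, x, hx, hc, ho⟩ |
        ⟨-, -, -, x, hx, hc, ho⟩ <;>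
      exact npq (D.pos_inj _ _ hq hx (hq'.unique ho) ▸ hc)
    · exact L.off_unique _ _ _ vp vq vr hpq cq hpr cr

/-- In a family of minimal total length, a detour lands directly above the height at which the line
it enters is left. -/
lemma eq_succ_of_minimal [Fintype ι] (hmin : L.IsMinimal) (i : ι) (hi : i ∈ D.J) :
    D.t i = D.s (D.σ i) + 1 := by
  classical
  have h := hmin D.reroute
  -- summed over all lines, the terms `s i - s (σ i)` cancel, so the rerouted family is shorter by
  -- the number of vertices skipped
  have e : ∀ i, (D.len i : ℤ) = L.len (D.σ i) + (D.s i - D.s (D.σ i)) -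
      (if i ∈ D.J then (D.t i - D.s (D.σ i) - 1 : ℤ) else 0) := by
    intro i
    by_cases hi : i ∈ D.J
    · have h1 := (D.off i hi).2.1
      simp only at h1
      simp only [len, hi, if_true]
      push_cast [Nat.cast_sub h1]
      ring
    · simp [len, hi, D.fix i hi]
  have h' : (∑ i, (L.len i : ℤ)) ≤ ∑ i, (D.len i : ℤ) := by exact_mod_cast h
  simp only [e, Finset.sum_sub_distrib, Finset.sum_add_distrib] at h'
  rw [Equiv.sum_comp D.σ (fun i => (L.len i : ℤ)), Equiv.sum_comp D.σ (fun i => (D.s i : ℤ))] at h'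
  have hnn : ∀ j ∈ Finset.univ, (0 : ℤ) ≤ if j ∈ D.J then (D.t j - D.s (D.σ j) - 1 : ℤ) else 0 := by
    intro j _
    split_ifs with hj
    · have := D.lt j hj; omega
    · rfl
  have h0 := Finset.single_le_sum hnn (Finset.mem_univ i)
  simp only [hi, if_true] at h0
  have := D.lt i hi
  omega

end Detour

/-! ### Partial paths in the processed part -/

/-- The positions of height less than `r i` on line `i`, for all `i`, form a set of positions closed
under off-path adjacency. Such a set is called the processed part below. -/
structure IsFrontier (L : Linkage G X Y ι) (r : ι → ℕ) : Prop where
  le : ∀ i, r i ≤ L.len i + 1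
  closed : ∀ p q, L.Off p q → p.2 < r p.1 → q.2 < r q.1

/-- The last processed vertex of line `a`, if there is one, can be reached from `X` within `S`. -/
def Reach (L : Linkage G X Y ι) (S : Set (ι × ℕ)) (r : ι → ℕ) (a : ι) : Prop :=
  ∀ k, k + 1 = r a → ∃ x ∈ X, ∃ w : G.Walk x (L.vert (a, k)), ∀ z ∈ w.support, z ∈ L.vert '' S

/-- The processed part contains two non-adjacent sets in which the last processed vertices of lines
`a` and `b`, respectively, can be reached from `X`, and which contain the last processed vertex of a
line only if that line is in `A`, respectively in `B`. On a line without processed vertices there is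
no condition. -/
def Realized (L : Linkage G X Y ι) (r : ι → ℕ) (a b : ι) (A B : Set ι) : Prop :=
  ∃ S T : Set (ι × ℕ), (∀ p ∈ S, p.2 < r p.1) ∧ (∀ p ∈ T, p.2 < r p.1) ∧
    (∀ p ∈ S, ∀ q ∈ T, p ≠ q ∧ ¬ G.Adj (L.vert p) (L.vert q)) ∧
    L.Reach S r a ∧ L.Reach T r b ∧
    (∀ i k, k + 1 = r i → (i, k) ∈ S → i ∈ A) ∧ (∀ i k, k + 1 = r i → (i, k) ∈ T → i ∈ B)

lemma Realized.swap {L : Linkage G X Y ι} {r : ι → ℕ} {a b : ι} {A B : Set ι}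
    (h : L.Realized r a b A B) : L.Realized r b a B A := by
  obtain ⟨S, T, hS, hT, hST, ha, hb, hA, hB⟩ := h
  exact ⟨T, S, hT, hS, fun p hp q hq => ⟨(hST q hq p hp).1.symm, fun h => (hST q hq p hp).2 h.symm⟩,
    hb, ha, hB, hA⟩

lemma realized_zero (L : Linkage G X Y ι) (a b : ι) (A B : Set ι) :
    L.Realized (fun _ => 0) a b A B :=
  ⟨∅, ∅, by simp, by simp, by simp, fun k hk => by simp at hk, fun k hk => by simp at hk,
    by simp, by simp⟩

/-- How a partial path ending on line `a` is continued through the new positions `N` to line `a'`: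
either line `a` receives no new position, or the path is continued to the next position of line `a`
and from there, possibly along one further edge, to the last new position of line `a'`. -/
def Extends (L : Linkage G X Y ι) (N : Set (ι × ℕ)) (r r' : ι → ℕ) (a a' : ι) : Prop :=
  (a' = a ∧ r' a = r a) ∨ ((a, r a) ∈ N ∧ ∃ k, k + 1 = r' a' ∧ (a', k) ∈ N ∧
    ((a', k) = (a, r a) ∨ G.Adj (L.vert (a, r a)) (L.vert (a', k))))

lemma Reach.extend {L : Linkage G X Y ι} {S N : Set (ι × ℕ)} {r r' : ι → ℕ} {a a' : ι}
    (hN : ∀ p ∈ N, p.2 ≤ L.len p.1) (h : L.Reach S r a) (hE : L.Extends N r r' a a') :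
    L.Reach (S ∪ N) r' a' := by
  rcases hE with ⟨rfl, hr⟩ | ⟨ha, k, hk, hk', hE⟩
  · intro k hk
    obtain ⟨x, hx, w, hw⟩ := h k (hk.trans hr)
    exact ⟨x, hx, w, fun z hz => Set.image_mono Set.subset_union_left (hw z hz)⟩
  · have h1 : ∃ x ∈ X, ∃ w : G.Walk x (L.vert (a, r a)),
        ∀ z ∈ w.support, z ∈ L.vert '' (S ∪ N) := by
      rcases Nat.eq_zero_or_eq_succ_pred (r a) with h0 | h0
      · refine ⟨L.vert (a, r a), by rw [h0]; exact L.start_mem a, Walk.nil, fun z hz => ?_⟩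
        rw [Walk.support_nil, List.mem_singleton] at hz
        exact ⟨_, Or.inr ha, hz.symm⟩
      · obtain ⟨x, hx, w, hw⟩ := h _ h0.symm
        have hadj : G.Adj (L.vert (a, (r a).pred)) (L.vert (a, r a)) := by
          have hl := hN _ ha
          have := L.adj a (r a).pred (by simp only at hl; omega)
          rwa [← Nat.succ_eq_add_one, ← h0] at this
        refine ⟨x, hx, w.concat hadj, fun z hz => ?_⟩
        rw [Walk.support_concat, List.mem_append, List.mem_singleton] at hz
        rcases hz with hz | rfl
        · exact Set.image_mono Set.subset_union_left (hw z hz)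
        · exact ⟨_, Or.inr ha, rfl⟩
    obtain ⟨x, hx, w, hw⟩ := h1
    intro k' hk1
    obtain rfl : k' = k := by omega
    rcases hE with hE | hE
    · rw [hE]; exact ⟨x, hx, w, hw⟩
    · refine ⟨x, hx, w.concat hE, fun z hz => ?_⟩
      rw [Walk.support_concat, List.mem_append, List.mem_singleton] at hz
      rcases hz with hz | rfl
      · exact hw z hz
      · exact ⟨_, Or.inr hk', rfl⟩

/-- The only edges from processed to unprocessed positions are those along the lines. -/
lemma IsFrontier.not_adj {L : Linkage G X Y ι} {r : ι → ℕ} (hr : L.IsFrontier r) {p q : ι × ℕ}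
    {A : Set ι} (hp : p.2 < r p.1) (hq : r q.1 ≤ q.2) (hq' : q.2 ≤ L.len q.1)
    (hA : p.2 + 1 = r p.1 → p.1 ∈ A) (hqA : q.2 = r q.1 → q.1 ∉ A) :
    p ≠ q ∧ ¬ G.Adj (L.vert p) (L.vert q) := by
  refine ⟨fun h => by subst h; omega, fun hadj => ?_⟩
  by_cases hc : Consec p q
  · obtain ⟨h1, h2⟩ := hc
    rw [← h1] at hq hqA
    exact hqA (by omega) (hA (by omega))
  · have := hr.closed p q ⟨by have := hr.le p.1; omega, hq', hadj, hc⟩ hp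
    omega

/-- Two non-adjacent partial paths are extended by non-adjacent sets `M`, `N` of new positions,
provided that neither set starts on a line whose last processed vertex belongs to the other partial
path. -/
lemma Realized.extend {L : Linkage G X Y ι} {r r' : ι → ℕ} {a b a' b' : ι} {A B A' B' : Set ι}
    (h : L.Realized r a b A B) (hr : L.IsFrontier r) (hrr : ∀ i, r i ≤ r' i)
    (hr' : ∀ i, r' i ≤ L.len i + 1) (M N : Set (ι × ℕ))
    (hM : ∀ p ∈ M, r p.1 ≤ p.2 ∧ p.2 < r' p.1) (hN : ∀ p ∈ N, r p.1 ≤ p.2 ∧ p.2 < r' p.1)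
    (hMN : ∀ p ∈ M, ∀ q ∈ N, p ≠ q ∧ ¬ G.Adj (L.vert p) (L.vert q))
    (hMB : ∀ i, (i, r i) ∈ M → i ∉ B) (hNA : ∀ i, (i, r i) ∈ N → i ∉ A)
    (ha : L.Extends M r r' a a') (hb : L.Extends N r r' b b')
    (hA : ∀ i, r' i = r i → i ∈ A → i ∈ A') (hA' : ∀ i k, k + 1 = r' i → (i, k) ∈ M → i ∈ A')
    (hB : ∀ i, r' i = r i → i ∈ B → i ∈ B') (hB' : ∀ i k, k + 1 = r' i → (i, k) ∈ N → i ∈ B') :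
    L.Realized r' a' b' A' B' := by
  obtain ⟨S, T, hS, hT, hST, hSa, hTb, hSA, hTB⟩ := h
  have hMv : ∀ p ∈ M, p.2 ≤ L.len p.1 := fun p hp => by
    have := hM p hp; have := hr' p.1; omega
  have hNv : ∀ p ∈ N, p.2 ≤ L.len p.1 := fun p hp => by
    have := hN p hp; have := hr' p.1; omega
  refine ⟨S ∪ M, T ∪ N, ?_, ?_, ?_, hSa.extend hMv ha, hTb.extend hNv hb, ?_, ?_⟩
  · rintro p (hp | hp)
    · exact (hS p hp).trans_le (hrr _)
    · exact (hM p hp).2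
  · rintro p (hp | hp)
    · exact (hT p hp).trans_le (hrr _)
    · exact (hN p hp).2
  · rintro p (hp | hp) q (hq | hq)
    · exact hST p hp q hq
    · exact hr.not_adj (A := A) (hS p hp) (hN q hq).1 (hNv q hq)
        (fun h => hSA _ _ h hp) (fun h => hNA _ (by rw [← h]; exact hq))
    · have := hr.not_adj (A := B) (hT q hq) (hM p hp).1 (hMv p hp)
        (fun h => hTB _ _ h hq) (fun h => hMB _ (by rw [← h]; exact hp))
      exact ⟨this.1.symm, fun h => this.2 h.symm⟩
    · exact hMN p hp q hq
  · rintro i k hk (hp | hp)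
    · have h1 := hS _ hp
      have h2 := hrr i
      simp only at h1
      have h3 : r' i = r i := by omega
      exact hA i h3 (hSA i k (by omega) hp)
    · exact hA' i k hk hp
  · rintro i k hk (hp | hp)
    · have h1 := hT _ hp
      have h2 := hrr i
      simp only at h1
      have h3 : r' i = r i := by omega
      exact hB i h3 (hTB i k (by omega) hp)
    · exact hB' i k hk hp

/-- Processing a vertex without off-path edge preserves everything realized. -/
lemma Realized.clear [DecidableEq ι] {L : Linkage G X Y ι} {r : ι → ℕ} {a b : ι} {A B : Set ι}
    (h : L.Realized r a b A B) (hr : L.IsFrontier r) (haA : a ∈ A) (hbB : b ∈ B) (haB : a ∉ B)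
    (hbA : b ∉ A) {i : ι} (hi : r i ≤ L.len i) :
    L.Realized (fun k => if k = i then r k + 1 else r k) a b A B := by
  have hext : ∀ c, L.Extends {p | p = (i, r i) ∧ i = c} r
      (fun k => if k = i then r k + 1 else r k) c c := by
    intro c
    by_cases hc : i = c
    · subst hc
      exact Or.inr ⟨⟨rfl, rfl⟩, r i, by simp, ⟨rfl, rfl⟩, Or.inl rfl⟩
    · exact Or.inl ⟨rfl, by simp [Ne.symm hc]⟩
  refine h.extend hr (fun k => ?_) (fun k => ?_) {p | p = (i, r i) ∧ i = a}
    {p | p = (i, r i) ∧ i = b} ?_ ?_ ?_ ?_ ?_ (hext a) (hext b) ?_ ?_ ?_ ?_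
  · split_ifs <;> omega
  · have := hr.le k
    split_ifs with h
    · subst h; omega
    · omega
  · rintro p ⟨rfl, -⟩; simp
  · rintro p ⟨rfl, -⟩; simp
  · rintro p ⟨-, rfl⟩ q ⟨-, rfl⟩; exact absurd haA hbA
  · rintro k ⟨h1, rfl⟩; rw [Prod.mk.injEq] at h1; rw [h1.1]; exact haB
  · rintro k ⟨h1, rfl⟩; rw [Prod.mk.injEq] at h1; rw [h1.1]; exact hbA
  · exact fun _ _ h => h
  · rintro k l - ⟨h1, rfl⟩; rw [Prod.mk.injEq] at h1; rw [h1.1]; exact haA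
  · exact fun _ _ h => h
  · rintro k l - ⟨h1, rfl⟩; rw [Prod.mk.injEq] at h1; rw [h1.1]; exact hbB

/-- Processing the two ends of an off-path edge between the next vertices of two lines, which the
transposition `σ` exchanges: a path arriving on one of these lines may stay there or change to the
other one, where in the latter case both lines are marked by it. -/
lemma Realized.rung [DecidableEq ι] {L : Linkage G X Y ι} {r : ι → ℕ} {a b : ι} {A B : Set ι}
    (h : L.Realized r a b A B) (hr : L.IsFrontier r) (σ : Equiv.Perm ι)
    (hσ : ∀ k, σ k ≠ k → L.Off (k, r k) (σ k, r (σ k)))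
    (hσ2 : ∀ k l, σ k ≠ k → σ l ≠ l → l = k ∨ l = σ k) {a' b' : ι} {A' B' : Set ι}
    (ha : a' = a ∨ a' = σ a) (hb : b' = b ∨ b' = σ b) (hab : b ≠ a) (hab' : b ≠ σ a)
    (haB : a ∉ B) (haB' : a' ∉ B) (hbA : b ∉ A) (hbA' : b' ∉ A)
    (hA : ∀ k, (if σ k = k then k ∈ A else k = a ∨ k = a') → k ∈ A')
    (hB : ∀ k, (if σ k = k then k ∈ B else k = b ∨ k = b') → k ∈ B') :
    L.Realized (fun k => if σ k = k then r k else r k + 1) a' b' A' B' := by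
  have hmov : ∀ c c', (c' = c ∨ c' = σ c) → σ c' ≠ c' → σ c ≠ c := by
    rintro c c' (rfl | rfl) h1 h2
    · exact h1 h2
    · exact h1 (by rw [h2, h2])
  have hext : ∀ c c', (c' = c ∨ c' = σ c) →
      L.Extends {p | σ p.1 ≠ p.1 ∧ p.2 = r p.1 ∧ (p.1 = c ∨ p.1 = c')} r
      (fun k => if σ k = k then r k else r k + 1) c c' := by
    intro c c' hc
    by_cases hm : σ c = c
    · have : c' = c := by rcases hc with hc | hc; exacts [hc, hc.trans hm]
      exact Or.inl ⟨this, by simp [hm]⟩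
    · refine Or.inr ⟨⟨hm, rfl, Or.inl rfl⟩, r c', ?_⟩
      rcases hc with rfl | rfl
      · exact ⟨by simp [hm], ⟨hm, rfl, Or.inr rfl⟩, Or.inl rfl⟩
      · have : σ (σ c) ≠ σ c := fun h => hm (σ.injective h)
        exact ⟨by simp [this], ⟨this, rfl, Or.inr rfl⟩, Or.inr (hσ c hm).2.2.1⟩
  refine h.extend hr (fun k => ?_) (fun k => ?_) _ _ ?_ ?_ ?_ ?_ ?_ (hext a a' ha) (hext b b' hb)
    ?_ ?_ ?_ ?_
  · split_ifs <;> omega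
  · split_ifs with hk
    · exact hr.le k
    · have := (hσ k hk).1; simp only at this; omega
  · rintro p ⟨h1, h2, -⟩; simp [h1, h2]
  · rintro p ⟨h1, h2, -⟩; simp [h1, h2]
  · rintro p ⟨h1, -, h2⟩ q ⟨h3, -, h4⟩
    have m1 : σ a ≠ a := by
      rcases h2 with h2 | h2
      · rwa [h2] at h1
      · exact hmov a a' ha (by rwa [h2] at h1)
    have m2 : σ b ≠ b := by
      rcases h4 with h4 | h4
      · rwa [h4] at h3
      · exact hmov b b' hb (by rwa [h4] at h3)
    rcases hσ2 a b m1 m2 with h5 | h5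
    · exact absurd h5 hab
    · exact absurd h5 hab'
  · rintro k ⟨-, -, rfl | rfl⟩
    exacts [haB, haB']
  · rintro k ⟨-, -, rfl | rfl⟩
    exacts [hbA, hbA']
  · intro k hk hk'
    apply hA
    have : σ k = k := by by_contra h; simp [h] at hk
    rwa [if_pos this]
  · rintro k l - ⟨h1, -, h2⟩
    exact hA k (by rwa [if_neg h1])
  · intro k hk hk'
    apply hB
    have : σ k = k := by by_contra h; simp [h] at hk
    rwa [if_pos this]
  · rintro k l - ⟨h1, -, h2⟩
    exact hB k (by rwa [if_neg h1])

/-- Processing two vertices on each line moved by `σ`, where the first of the two on line `k` is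
joined to the second on line `σ k`: a path arriving on line `k` may leave on `k` or on `σ k`. These
vertices induce cycles in which each path uses two consecutive vertices, the first vertex of the
line on which it arrives and the second vertex of the line on which it leaves; the hypotheses on
`a'` and `b'` say that the two pairs are not adjacent. -/
lemma Realized.block [DecidableEq ι] {L : Linkage G X Y ι} {r : ι → ℕ} {a b : ι} {A B : Set ι}
    (h : L.Realized r a b A B) (hr : L.IsFrontier r) (σ : Equiv.Perm ι)
    (hσ : ∀ k, σ k ≠ k → L.Off (k, r k) (σ k, r (σ k) + 1)) {a' b' : ι} {A' B' : Set ι}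
    (ha : a' = a ∨ a' = σ a) (hb : b' = b ∨ b' = σ b) (hba : b' ≠ a) (hba' : b' ≠ σ a)
    (hab : a' ≠ b) (hab' : a' ≠ σ b) (haB : a ∉ B) (hbA : b ∉ A)
    (hA : ∀ k, (if σ k = k then k ∈ A else k = a') → k ∈ A')
    (hB : ∀ k, (if σ k = k then k ∈ B else k = b') → k ∈ B') :
    L.Realized (fun k => if σ k = k then r k else r k + 2) a' b' A' B' := by
  have hmov : ∀ c c', (c' = c ∨ c' = σ c) → σ c ≠ c → σ c' ≠ c' := by
    rintro c c' (rfl | rfl) h1 h2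
    · exact h1 h2
    · exact h1 (σ.injective h2)
  have hadj1 : ∀ k, σ k ≠ k → G.Adj (L.vert (k, r k)) (L.vert (k, r k + 1)) := by
    intro k hk
    have h1 := (hσ (σ.symm k) (fun h => hk (by
      rw [Equiv.apply_symm_apply] at h; rw [Equiv.eq_symm_apply] at h; exact h))).2.1
    simp only [Equiv.apply_symm_apply] at h1
    exact L.adj k _ h1
  have hext : ∀ c c', (c' = c ∨ c' = σ c) →
      L.Extends {p | σ c ≠ c ∧ (p = (c, r c) ∨ p = (c', r c' + 1))} r
      (fun k => if σ k = k then r k else r k + 2) c c' := by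
    intro c c' hc
    by_cases hm : σ c = c
    · have : c' = c := by rcases hc with hc | hc; exacts [hc, hc.trans hm]
      exact Or.inl ⟨this, by simp [hm]⟩
    · refine Or.inr ⟨⟨hm, Or.inl rfl⟩, r c' + 1, by simp [hmov c c' hc hm], ⟨hm, Or.inr rfl⟩,
        Or.inr ?_⟩
      rcases hc with rfl | rfl
      · exact hadj1 _ hm
      · exact (hσ c hm).2.2.1
  have hlo : ∀ c c', (c' = c ∨ c' = σ c) →
      ∀ p ∈ {p : ι × ℕ | σ c ≠ c ∧ (p = (c, r c) ∨ p = (c', r c' + 1))},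
      r p.1 ≤ p.2 ∧ p.2 < if σ p.1 = p.1 then r p.1 else r p.1 + 2 := by
    rintro c c' hc p ⟨h1, rfl | rfl⟩
    · simp [h1]
    · simp [hmov c c' hc h1]
  have hne : ∀ c c' : ι, c ≠ c' → ∀ x y, ¬ Consec (c, x) (c', y) := fun c c' h x y h' => h h'.1
  have hv : ∀ k, σ k ≠ k → r k + 1 ≤ L.len k := by
    intro k hk
    have h1 := (hσ (σ.symm k) (fun h => hk (by
      rw [Equiv.apply_symm_apply] at h; rw [Equiv.eq_symm_apply] at h; exact h))).2.1
    simpa only [Equiv.apply_symm_apply] using h1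
  have hoff : ∀ c d x y, σ c ≠ c → σ d ≠ d → c ≠ d → x ≤ r c + 1 → y ≤ r d + 1 →
      G.Adj (L.vert (c, x)) (L.vert (d, y)) → L.Off (c, x) (d, y) := by
    intro c d x y hc hd hcd hx hy hadj
    exact ⟨hx.trans (hv c hc), hy.trans (hv d hd), hadj, hne c d hcd _ _⟩
  have hab2 : a ≠ b := by
    rintro rfl
    rcases hb with hb | hb
    exacts [hba hb, hba' hb]
  have hab2' : a' ≠ b' := by
    rintro rfl
    rcases ha with ha | ha
    exacts [hba ha, hba' ha]
  refine h.extend hr (fun k => ?_) (fun k => ?_) _ _ (hlo a a' ha) (hlo b b' hb) ?_ ?_ ?_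
    (hext a a' ha) (hext b b' hb) ?_ ?_ ?_ ?_
  · split_ifs <;> omega
  · split_ifs with hk
    · exact hr.le k
    · have := hv k hk; omega
  · rintro p ⟨ma, hp⟩ q ⟨mb, hq⟩
    have ma' := hmov a a' ha ma
    have mb' := hmov b b' hb mb
    rcases hp with rfl | rfl <;> rcases hq with rfl | rfl
    · refine ⟨fun h => hab2 (Prod.mk.inj h).1, fun hadj => ?_⟩
      have h1 := (hoff a b _ _ ma mb hab2 (by omega) (by omega) hadj).unique (hσ a ma)
      rw [Prod.mk.injEq] at h1
      rw [← h1.1] at h1; omega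
    · refine ⟨fun h => hba (Prod.mk.inj h).1.symm, fun hadj => ?_⟩
      have h1 := (hoff a b' _ _ ma mb' hba.symm (by omega) (by omega) hadj).unique (hσ a ma)
      exact hba' (Prod.mk.inj h1).1
    · refine ⟨fun h => hab (Prod.mk.inj h).1, fun hadj => ?_⟩
      have h1 := (hoff b a' _ _ mb ma' hab.symm (by omega) (by omega) hadj.symm).unique (hσ b mb)
      exact hab' (Prod.mk.inj h1).1
    · refine ⟨fun h => hab2' (Prod.mk.inj h).1, fun hadj => ?_⟩
      have h0 : σ (σ.symm a') ≠ σ.symm a' := fun h => ma' (by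
        rw [Equiv.apply_symm_apply] at h; rw [Equiv.eq_symm_apply] at h; exact h)
      have h2 := hσ _ h0
      rw [Equiv.apply_symm_apply] at h2
      have h1 := (hoff a' b' _ _ ma' mb' hab2' (by omega) (by omega) hadj).unique h2.symm
      rw [Prod.mk.injEq] at h1
      rw [h1.1] at h1; omega
  · rintro k ⟨-, h1 | h1⟩
    · rw [(Prod.mk.inj h1).1]; exact haB
    · rw [Prod.mk.injEq] at h1; rw [h1.1] at h1; omega
  · rintro k ⟨-, h1 | h1⟩
    · rw [(Prod.mk.inj h1).1]; exact hbA
    · rw [Prod.mk.injEq] at h1; rw [h1.1] at h1; omega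
  · intro k hk hk'
    apply hA
    have : σ k = k := by by_contra h; simp [h] at hk
    rwa [if_pos this]
  · rintro k l hl ⟨h0, h1 | h1⟩
    · obtain ⟨rfl, rfl⟩ := Prod.mk.inj h1
      simp [h0] at hl
    · obtain ⟨rfl, rfl⟩ := Prod.mk.inj h1
      exact hA k (by rw [if_neg (hmov a k ha h0)])
  · intro k hk hk'
    apply hB
    have : σ k = k := by by_contra h; simp [h] at hk
    rwa [if_pos this]
  · rintro k l hl ⟨h0, h1 | h1⟩
    · obtain ⟨rfl, rfl⟩ := Prod.mk.inj h1
      simp [h0] at hl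
    · obtain ⟨rfl, rfl⟩ := Prod.mk.inj h1
      exact hB k (by rw [if_neg (hmov b k hb h0)])

/-- The same family with its lines renamed. -/
def reindex (L : Linkage G X Y ι) (e : Equiv.Perm ι) : Linkage G X Y ι where
  len i := L.len (e i)
  vert p := L.vert (e p.1, p.2)
  inj p q hp hq h := by
    have := L.inj (e p.1, p.2) (e q.1, q.2) hp hq h
    rw [Prod.mk.injEq] at this
    exact Prod.ext (e.injective this.1) this.2
  adj i a ha := L.adj (e i) a ha
  start_mem i := L.start_mem (e i)
  end_mem i := L.end_mem (e i)
  off_unique p q r hp hq hr h1 h2 h3 h4 := by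
    have := L.off_unique (e p.1, p.2) (e q.1, q.2) (e r.1, r.2) hp hq hr h1
      (fun h => h2 ⟨e.injective h.1, h.2⟩) h3 (fun h => h4 ⟨e.injective h.1, h.2⟩)
    rw [Prod.mk.injEq] at this
    exact Prod.ext (e.injective this.1) this.2

lemma reindex_off {L : Linkage G X Y ι} {e : Equiv.Perm ι} {p q : ι × ℕ} :
    (L.reindex e).Off p q ↔ L.Off (e p.1, p.2) (e q.1, q.2) := by
  simp [Off, reindex, Consec]

lemma IsFrontier.reindex {L : Linkage G X Y ι} {r : ι → ℕ} (hr : L.IsFrontier r)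
    (e : Equiv.Perm ι) : (L.reindex e).IsFrontier (r ∘ e) :=
  ⟨fun i => hr.le (e i), fun _ _ h h' => hr.closed _ _ (reindex_off.1 h) h'⟩

lemma Realized.reindex {L : Linkage G X Y ι} {r : ι → ℕ} {e : Equiv.Perm ι} {a b : ι}
    {A B A' B' : Set ι} (h : L.Realized r (e a) (e b) A B) (hA : ∀ i, e i ∈ A → i ∈ A')
    (hB : ∀ i, e i ∈ B → i ∈ B') : (L.reindex e).Realized (r ∘ e) a b A' B' := by
  obtain ⟨S, T, hS, hT, hST, hSa, hTb, hSA, hTB⟩ := h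
  have hreach : ∀ U c, L.Reach U r (e c) →
      (L.reindex e).Reach {p | (e p.1, p.2) ∈ U} (r ∘ e) c := by
    intro U c hU k hk
    obtain ⟨x, hx, w, hw⟩ := hU k hk
    refine ⟨x, hx, w, fun z hz => ?_⟩
    obtain ⟨p, hp, rfl⟩ := hw z hz
    exact ⟨(e.symm p.1, p.2), by simpa using hp, by simp [Linkage.reindex]⟩
  exact ⟨{p | (e p.1, p.2) ∈ S}, {p | (e p.1, p.2) ∈ T}, fun p hp => hS _ hp, fun p hp => hT _ hp,
    fun p hp q hq => ⟨fun h => (hST _ hp _ hq).1 (by rw [h]), (hST _ hp _ hq).2⟩,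
    hreach S a hSa, hreach T b hTb, fun i k hk hp => hA i (hSA _ k hk hp),
    fun i k hk hp => hB i (hTB _ k hk hp)⟩

/-- When everything is processed, a realized configuration gives two non-adjacent paths. -/
lemma Realized.exists_nonAdjacent {L : Linkage G X Y ι} {r : ι → ℕ} {a b : ι} {A B : Set ι}
    (h : L.Realized r a b A B) (hr : ∀ i, r i = L.len i + 1) :
    ∃ P Q : G.XYPath X Y, P.NonAdjacent Q := by
  classical
  obtain ⟨S, T, hS, hT, hST, hSa, hTb, -, -⟩ := h
  obtain ⟨x, hx, w, hw⟩ := hSa (L.len a) (hr a).symm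
  obtain ⟨y, hy, u, hu⟩ := hTb (L.len b) (hr b).symm
  refine ⟨⟨x, _, hx, L.end_mem a, w.bypass, w.bypass_isPath⟩,
    ⟨y, _, hy, L.end_mem b, u.bypass, u.bypass_isPath⟩, ?_, ?_⟩
  · rw [Set.disjoint_left]
    intro z hz hz'
    obtain ⟨p, hp, h1⟩ := hw z (w.support_bypass_subset_support hz)
    obtain ⟨q, hq, h2⟩ := hu z (u.support_bypass_subset_support hz')
    have h3 := hS p hp
    have h4 := hT q hq
    rw [hr] at h3 h4
    exact (hST p hp q hq).1 (L.inj p q (by omega) (by omega) (h1.trans h2.symm))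
  · intro z hz z' hz'
    obtain ⟨p, hp, rfl⟩ := hw z (w.support_bypass_subset_support hz)
    obtain ⟨q, hq, rfl⟩ := hu z' (u.support_bypass_subset_support hz')
    exact (hST p hp q hq).2

end Linkage

/-! ### Sweeping over a minimal family -/

/-- A self-map of a finite set that is not the identity, and under which the set of non-fixed points
is stable, agrees with a permutation other than the identity wherever the latter moves a point. -/
lemma exists_perm_of_moves {ι : Type*} [Finite ι] (f : ι → ι) (i : ι) (hi : f i ≠ i)
    (hf : ∀ j, f j ≠ j → f (f j) ≠ f j) :
    ∃ σ : Equiv.Perm ι, (∀ j, σ j ≠ j → σ j = f j) ∧ ∃ j, σ j ≠ j := by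
  classical
  have hbij := Function.bijOn_periodicPts (f := f)
  refine ⟨Equiv.Perm.ofSubtype (p := (· ∈ Function.periodicPts f))
    (Equiv.ofBijective _ hbij.bijective), ?_, ?_⟩
  · intro j hj
    by_cases h : j ∈ Function.periodicPts f
    · rw [Equiv.Perm.ofSubtype_apply_of_mem _ h]; rfl
    · exact absurd (Equiv.Perm.ofSubtype_apply_of_not_mem _ h) hj
  · have hit : ∀ n, f (f^[n] i) ≠ f^[n] i := by
      intro n
      induction n with
      | zero => exact hi
      | succ n ih => rw [Function.iterate_succ_apply']; exact hf _ ih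
    obtain ⟨m, n, hmn, h⟩ := Finite.exists_ne_map_eq_of_infinite (fun n => f^[n] i)
    wlog hlt : m < n generalizing m n
    · exact this n m hmn.symm h.symm (by omega)
    have hp : f^[m] i ∈ Function.periodicPts f := by
      refine ⟨n - m, by omega, ?_⟩
      rw [Function.IsPeriodicPt, Function.IsFixedPt, ← Function.iterate_add_apply,
        Nat.sub_add_cancel hlt.le, h]
    refine ⟨f^[m] i, ?_⟩
    rw [Equiv.Perm.ofSubtype_apply_of_mem _ hp]
    exact hit m

namespace Linkage

variable {V : Type*} {G : SimpleGraph V} {X Y : Set V} {ι : Type*}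

lemma exists_isMinimal [Fintype ι] (L : Linkage G X Y ι) :
    ∃ L' : Linkage G X Y ι, L'.IsMinimal := by
  classical
  have h : ∃ n, ∃ L' : Linkage G X Y ι, ∑ i, L'.len i = n := ⟨_, L, rfl⟩
  obtain ⟨L', hL'⟩ := Nat.find_spec h
  exact ⟨L', fun L'' => hL' ▸ Nat.find_min' h ⟨L'', rfl⟩⟩

lemma IsMinimal.reindex [Fintype ι] {L : Linkage G X Y ι} (hL : L.IsMinimal) (e : Equiv.Perm ι) :
    (L.reindex e).IsMinimal := fun L' => by
  have : ∑ i, (L.reindex e).len i = ∑ i, L.len i := Equiv.sum_comp e L.len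
  rw [this]
  exact hL L'

/-- In a minimal family, off-path edges join different lines. -/
lemma IsMinimal.off_ne [Fintype ι] {L : Linkage G X Y ι} (hL : L.IsMinimal) {p q : ι × ℕ}
    (h : L.Off p q) : p.1 ≠ q.1 := by
  intro h1
  wlog hlt : p.2 ≤ q.2 generalizing p q
  · exact this h.symm h1.symm (by omega)
  obtain ⟨i, a⟩ := p
  obtain ⟨j, b⟩ := q
  simp only at h1 hlt
  subst h1
  have hne : a ≠ b := by rintro rfl; exact G.loopless.irrefl _ h.2.2.1
  -- the edge is a chord of line `i`, which can be used as a shortcut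
  let D : Detour L :=
    { J := {i}, σ := 1, s := fun _ => a, t := fun _ => b, fix := fun _ _ => rfl
      lt := fun _ _ => lt_of_le_of_ne hlt hne
      off := by rintro _ rfl; exact h }
  have := D.eq_succ_of_minimal hL i rfl
  exact h.2.2.2 ⟨rfl, Or.inl this.symm⟩

lemma isFrontier_zero (L : Linkage G X Y ι) : L.IsFrontier (fun _ => 0) :=
  ⟨fun _ => Nat.zero_le _, fun _ _ _ h => absurd h (Nat.not_lt_zero _)⟩

lemma IsFrontier.clear [DecidableEq ι] {L : Linkage G X Y ι} {r : ι → ℕ} (hr : L.IsFrontier r)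
    {i : ι} (hi : r i ≤ L.len i) (hoff : ∀ q, ¬ L.Off (i, r i) q) :
    L.IsFrontier (fun k => if k = i then r k + 1 else r k) := by
  refine ⟨fun k => ?_, fun p q h hp => ?_⟩
  · split_ifs with hk
    · subst hk; omega
    · exact hr.le k
  · have hp' : p.2 < r p.1 := by
      by_contra h0
      by_cases hk : p.1 = i
      · simp only [hk, if_true] at hp
        rw [hk] at h0
        exact hoff q (by rwa [show (i, r i) = p from Prod.ext hk.symm (by simp only; omega)])
      · simp only [hk, if_false] at hp; exact h0 hp
    have := hr.closed p q h hp'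
    split_ifs <;> omega

lemma IsFrontier.rung [DecidableEq ι] {L : Linkage G X Y ι} {r : ι → ℕ} (hr : L.IsFrontier r)
    {σ : Equiv.Perm ι} (hσ : ∀ k, σ k ≠ k → L.Off (k, r k) (σ k, r (σ k))) :
    L.IsFrontier (fun k => if σ k = k then r k else r k + 1) := by
  refine ⟨fun k => ?_, fun p q h hp => ?_⟩
  · split_ifs with hk
    · exact hr.le k
    · have := (hσ k hk).1; simp only at this; omega
  · by_cases hp' : p.2 < r p.1
    · have := hr.closed p q h hp'
      split_ifs <;> omega
    · by_cases hk : σ p.1 = p.1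
      · simp only [hk, if_true] at hp; omega
      · simp only [hk, if_false] at hp
        have h1 : p = (p.1, r p.1) := Prod.ext rfl (by simp only; omega)
        rw [h1] at h
        have h2 := h.unique (hσ _ hk)
        have h3 : σ (σ p.1) ≠ σ p.1 := fun h => hk (σ.injective h)
        rw [h2]
        simp [h3]

lemma IsFrontier.block [DecidableEq ι] {L : Linkage G X Y ι} {r : ι → ℕ} (hr : L.IsFrontier r)
    {σ : Equiv.Perm ι} (hσ : ∀ k, σ k ≠ k → L.Off (k, r k) (σ k, r (σ k) + 1)) :
    L.IsFrontier (fun k => if σ k = k then r k else r k + 2) := by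
  have hinv : ∀ k, σ k ≠ k → σ (σ.symm k) ≠ σ.symm k := fun k hk h => hk (by
    rw [Equiv.apply_symm_apply] at h; rw [Equiv.eq_symm_apply] at h; exact h)
  refine ⟨fun k => ?_, fun p q h hp => ?_⟩
  · split_ifs with hk
    · exact hr.le k
    · have := (hσ _ (hinv k hk)).2.1; simp only [Equiv.apply_symm_apply] at this; omega
  · by_cases hp' : p.2 < r p.1
    · have := hr.closed p q h hp'
      split_ifs <;> omega
    · by_cases hk : σ p.1 = p.1
      · simp only [hk, if_true] at hp; omega
      · simp only [hk, if_false] at hp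
        by_cases h0 : p.2 = r p.1
        · have h1 : p = (p.1, r p.1) := Prod.ext rfl h0
          rw [h1] at h
          have h2 := h.unique (hσ _ hk)
          have h3 : σ (σ p.1) ≠ σ p.1 := fun h => hk (σ.injective h)
          rw [h2]
          simp [h3]
        · have h1 : p = (p.1, r p.1 + 1) := Prod.ext rfl (by simp only; omega)
          rw [h1] at h
          have h4 := hσ _ (hinv _ hk)
          rw [Equiv.apply_symm_apply] at h4
          have h2 := h.unique h4.symm
          rw [h2]
          have := hinv _ hk
          rw [Equiv.apply_symm_apply] at this
          simp [this.symm, Ne.symm]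

/-- In a minimal family, as long as some line is not completely processed, one of three things
happens: the next vertex of some line has no off-path edge, or the next vertices of two lines are
joined, or for some permutation `σ` of the lines the next vertex of each line `k` moved by `σ` is
joined to the vertex after the next of line `σ k`. -/
theorem IsMinimal.exists_next [Fintype ι] [DecidableEq ι] {L : Linkage G X Y ι} (hL : L.IsMinimal)
    {r : ι → ℕ} (hr : L.IsFrontier r) {i₀ : ι} (hi₀ : r i₀ ≤ L.len i₀) :
    (∃ i, r i ≤ L.len i ∧ ∀ q, ¬ L.Off (i, r i) q) ∨
    (∃ i j, i ≠ j ∧ L.Off (i, r i) (j, r j)) ∨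
    (∃ σ : Equiv.Perm ι, (∃ k, σ k ≠ k) ∧ ∀ k, σ k ≠ k → L.Off (k, r k) (σ k, r (σ k) + 1)) := by
  by_contra! hcon
  obtain ⟨h1, h2, h3⟩ := hcon
  choose! m hm using h1
  have hlow : ∀ i, r i ≤ L.len i → r (m i).1 < (m i).2 := by
    intro i hi
    by_contra hlt
    rcases Nat.lt_or_eq_of_le (not_lt.1 hlt) with hlt | heq
    · exact lt_irrefl _ (hr.closed _ _ (hm i hi).symm hlt)
    · refine h2 i (m i).1 (hL.off_ne (hm i hi)) ?_
      rw [← heq]; exact hm i hi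
  -- every unfinished line is blocked by the line on which the neighbour of its next vertex lies
  let f : ι → ι := fun i => if r i ≤ L.len i then (m i).1 else i
  have hf : ∀ i, f i ≠ i ↔ r i ≤ L.len i := by
    intro i
    by_cases hi : r i ≤ L.len i
    · simpa [f, hi] using (hL.off_ne (hm i hi)).symm
    · simp [f, hi]
  have hf' : ∀ i, r i ≤ L.len i → f i = (m i).1 := fun i hi => by simp [f, hi]
  obtain ⟨σ, hσ, hmov⟩ := exists_perm_of_moves f i₀ ((hf _).2 hi₀) (fun j hj => by
    rw [hf] at hj ⊢
    rw [hf' j hj]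
    exact (hlow j hj).le.trans (hm j hj).2.1)
  have hact : ∀ k, σ k ≠ k → r k ≤ L.len k ∧ (m k).1 = σ k := by
    intro k hk
    have h4 : r k ≤ L.len k := (hf k).1 (by rwa [← hσ k hk])
    exact ⟨h4, by rw [hσ k hk, hf' k h4]⟩
  -- along a cycle of blocked lines the family can be rerouted
  let D : Detour L :=
    { J := {k | σ k ≠ k}, σ := σ, s := r, t := fun k => (m k).2
      fix := fun k hk => not_not.1 hk
      lt := fun k hk => by
        rw [← (hact k hk).2]
        exact hlow k (hact k hk).1
      off := fun k hk => by
        rw [← (hact k hk).2]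
        exact hm k (hact k hk).1 }
  obtain ⟨k, hk, hno⟩ := h3 σ hmov
  have h5 := D.eq_succ_of_minimal hL k hk
  exact hno (by have := D.off k hk; rwa [h5] at this)

end Linkage

/-! ### From paths to lines -/

namespace XYPath

variable {V : Type*} {G : SimpleGraph V} {X Y : Set V} {ι : Type*}

lemma getVert_mem_verts (P : XYPath G X Y) (a : ℕ) : P.walk.getVert a ∈ P.verts :=
  P.walk.getVert_mem_support a

lemma PairwiseDisjoint.getVert_inj {𝓟 : ι → XYPath G X Y} (hd : PairwiseDisjoint 𝓟) {i j : ι}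
    {a b : ℕ} (ha : a ≤ (𝓟 i).walk.length) (hb : b ≤ (𝓟 j).walk.length)
    (h : (𝓟 i).walk.getVert a = (𝓟 j).walk.getVert b) : i = j ∧ a = b := by
  have hij : i = j := by
    by_contra hij
    refine Set.disjoint_left.1 (hd hij) (getVert_mem_verts (𝓟 i) a) ?_
    rw [h]
    exact getVert_mem_verts (𝓟 j) b
  subst hij
  exact ⟨rfl, (𝓟 i).isPath.getVert_injOn ha hb h⟩

/-- A family of disjoint paths whose vertices are incident to at most one further edge, in
coordinates. -/
def toLinkage (𝓟 : ι → XYPath G X Y) (hd : PairwiseDisjoint 𝓟) (ho : AtMostOneEdgeOff 𝓟) :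
    Linkage G X Y ι where
  len i := (𝓟 i).walk.length
  vert p := (𝓟 p.1).walk.getVert p.2
  inj p q hp hq h := Prod.ext (hd.getVert_inj hp hq h).1 (hd.getVert_inj hp hq h).2
  adj i a ha := (𝓟 i).walk.adj_getVert_succ ha
  start_mem i := by simpa using (𝓟 i).source_mem
  end_mem i := by simpa using (𝓟 i).target_mem
  off_unique := by
    have key : ∀ p q : ι × ℕ, p.2 ≤ (𝓟 p.1).walk.length → q.2 ≤ (𝓟 q.1).walk.length →
        G.Adj ((𝓟 p.1).walk.getVert p.2) ((𝓟 q.1).walk.getVert q.2) → ¬ Consec p q →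
        s((𝓟 p.1).walk.getVert p.2, (𝓟 q.1).walk.getVert q.2) ∈
          G.incidenceSet ((𝓟 p.1).walk.getVert p.2) \ ⋃ i, (𝓟 i).edges := by
      intro p q hp hq hadj hc
      refine ⟨⟨hadj, Sym2.mem_mk_left _ _⟩, fun h => hc ?_⟩
      obtain ⟨k, hk⟩ := Set.mem_iUnion.1 h
      obtain ⟨c, hc, he⟩ := (Walk.mk_mem_edges_iff_exists _).1 hk
      rw [Sym2.eq_iff] at he
      rcases he with ⟨h1, h2⟩ | ⟨h1, h2⟩
      · have h3 := hd.getVert_inj hc.le hp h1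
        have h4 := hd.getVert_inj hc hq h2
        exact ⟨h3.1.symm.trans h4.1, Or.inl (by omega)⟩
      · have h3 := hd.getVert_inj hc.le hq h1
        have h4 := hd.getVert_inj hc hp h2
        exact ⟨h4.1.symm.trans h3.1, Or.inr (by omega)⟩
    intro p q r hp hq hr h1 h2 h3 h4
    have h5 := key p q hp hq h1 h2
    have h6 := key p r hp hr h3 h4
    have h7 := Set.encard_le_one_iff.1
      (ho _ (Set.mem_iUnion.2 ⟨p.1, getVert_mem_verts (𝓟 p.1) p.2⟩)) _ _ h5 h6
    rw [Sym2.congr_right] at h7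
    exact Prod.ext (hd.getVert_inj hq hr h7).1 (hd.getVert_inj hq hr h7).2

end XYPath

/-! ### The automaton for five lines -/

/-- Digit `i` of `n` (reduced modulo `5`), counted from the left among its last five digits, as an
element of `{0, 1, 2, 3, 4}`. A map from `Fin 5` to itself is encoded by the number with its values
as digits. Here and below, the operations on `ℕ` are those that the kernel evaluates directly. -/
def digit (n i : ℕ) : ℕ := Nat.mod (Nat.div n (Nat.pow 10 (Nat.sub 4 i))) 5

/-- Membership of `i` in the set with bit mask `m`. -/
def bit (m i : ℕ) : Bool := Nat.beq (Nat.land (Nat.shiftRight m i) 1) 1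

/-- A configuration on five lines: the lines `a`, `b` on which the two partial paths end, and the
sets of lines, as bit masks, whose last processed vertex may lie on the first, respectively on the
second partial path. -/
structure Config where
  a : ℕ
  b : ℕ
  A : ℕ
  B : ℕ

namespace Config

/-- The configuration with the two partial paths exchanged. -/
def swap (c : Config) : Config := ⟨c.b, c.a, c.B, c.A⟩

/-- Each partial path, and only it, contains the last vertex of the line on which it ends. -/
def proper (c : Config) : Bool :=
  Nat.blt c.a 5 && Nat.blt c.b 5 && bit c.A c.a && bit c.B c.b && !bit c.B c.a && !bit c.A c.b

/-- `q` is `x` or its image under the map encoded by `s`. -/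
def stays (s x q : ℕ) : Bool := Nat.beq q x || Nat.beq q (digit s x)

/-- The hypotheses of `Linkage.Realized.rung` for the permutation encoded by `s`, where the
resulting configuration is `d` with each line renamed by the map encoded by `p`. -/
def rungStep (s : ℕ) (c : Config) (p : ℕ) (d : Config) : Bool :=
  stays s c.a (digit p d.a) && (stays s c.b (digit p d.b) && (!stays s c.a c.b &&
  (!bit c.B (digit p d.a) && (!bit c.A (digit p d.b) &&
  [0, 1, 2, 3, 4].all fun k =>
    (bit d.A k || !bif Nat.beq (digit s (digit p k)) (digit p k) then bit c.A (digit p k)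
      else Nat.beq (digit p k) c.a || Nat.beq (digit p k) (digit p d.a)) &&
    (bit d.B k || !bif Nat.beq (digit s (digit p k)) (digit p k) then bit c.B (digit p k)
      else Nat.beq (digit p k) c.b || Nat.beq (digit p k) (digit p d.b))))))

/-- The hypotheses of `Linkage.Realized.block` for the permutation encoded by `s`, where the
resulting configuration is `d` with each line renamed by the map encoded by `p`. -/
def blockStep (s : ℕ) (c : Config) (p : ℕ) (d : Config) : Bool :=
  stays s c.a (digit p d.a) && (stays s c.b (digit p d.b) &&
  (!stays s c.a (digit p d.b) && (!stays s c.b (digit p d.a) &&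
  [0, 1, 2, 3, 4].all fun k =>
    (bit d.A k || !bif Nat.beq (digit s (digit p k)) (digit p k) then bit c.A (digit p k)
      else Nat.beq (digit p k) (digit p d.a)) &&
    (bit d.B k || !bif Nat.beq (digit s (digit p k)) (digit p k) then bit c.B (digit p k)
      else Nat.beq (digit p k) (digit p d.b)))))

end Config

/-- The states of the automaton: families of configurations, each written as `⟨a, b, A, B⟩` with bit
`i` of the masks, counted from the right, standing for line `i`. By `rung_certified` and
`block_certified`, a step leads from each family to one of them, with lines renamed. -/
def stateTable : List (List Config) := [
  [⟨0, 2, 0b10001, 0b00110⟩, ⟨1, 2, 0b00010, 0b11100⟩, ⟨0, 2, 0b11001, 0b00100⟩,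
   ⟨1, 3, 0b00011, 0b11000⟩, ⟨1, 3, 0b00010, 0b11100⟩, ⟨0, 4, 0b00011, 0b10100⟩,
   ⟨0, 4, 0b00001, 0b11100⟩, ⟨0, 4, 0b01001, 0b10010⟩, ⟨2, 4, 0b01101, 0b10000⟩,
   ⟨3, 4, 0b01001, 0b10100⟩],
  [⟨1, 3, 0b00010, 0b11100⟩, ⟨0, 3, 0b00101, 0b11000⟩, ⟨3, 2, 0b11001, 0b00100⟩,
   ⟨3, 2, 0b11010, 0b00100⟩, ⟨1, 3, 0b10011, 0b01000⟩, ⟨0, 4, 0b01101, 0b10000⟩,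
   ⟨2, 4, 0b01100, 0b10000⟩],
  [⟨1, 3, 0b10011, 0b01000⟩, ⟨1, 3, 0b10010, 0b01100⟩, ⟨0, 4, 0b00101, 0b11000⟩,
   ⟨2, 4, 0b00100, 0b11000⟩, ⟨3, 4, 0b01001, 0b10100⟩, ⟨3, 4, 0b01010, 0b10100⟩,
   ⟨4, 3, 0b10001, 0b01100⟩, ⟨3, 4, 0b01110, 0b10000⟩],
  [⟨2, 1, 0b00101, 0b10010⟩, ⟨0, 3, 0b00101, 0b11000⟩, ⟨0, 4, 0b00001, 0b10110⟩,
   ⟨0, 4, 0b00101, 0b10000⟩, ⟨4, 2, 0b10001, 0b00100⟩, ⟨0, 4, 0b01001, 0b10100⟩],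
  [⟨0, 2, 0b11001, 0b00100⟩, ⟨1, 3, 0b00010, 0b11100⟩, ⟨3, 2, 0b11001, 0b00100⟩,
   ⟨3, 2, 0b11010, 0b00100⟩, ⟨0, 4, 0b00101, 0b11000⟩, ⟨2, 4, 0b00110, 0b11000⟩,
   ⟨0, 4, 0b01101, 0b10000⟩, ⟨3, 4, 0b01101, 0b10000⟩],
  [⟨1, 2, 0b11010, 0b00100⟩, ⟨0, 3, 0b00101, 0b11000⟩, ⟨3, 2, 0b11001, 0b00100⟩,
   ⟨3, 2, 0b11010, 0b00100⟩, ⟨0, 4, 0b00101, 0b10010⟩, ⟨2, 4, 0b00111, 0b10000⟩,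
   ⟨0, 4, 0b00101, 0b11000⟩, ⟨4, 2, 0b11001, 0b00100⟩],
  [⟨0, 2, 0b00011, 0b01100⟩, ⟨0, 2, 0b00001, 0b11100⟩, ⟨1, 3, 0b00110, 0b11000⟩,
   ⟨1, 3, 0b10010, 0b01100⟩, ⟨2, 3, 0b10101, 0b01000⟩, ⟨3, 2, 0b01010, 0b10100⟩,
   ⟨3, 4, 0b01100, 0b10000⟩],
  [⟨0, 4, 0b00101, 0b10010⟩, ⟨0, 4, 0b00111, 0b10000⟩, ⟨2, 4, 0b00101, 0b10010⟩,
   ⟨4, 2, 0b10001, 0b00110⟩, ⟨0, 4, 0b00101, 0b11000⟩, ⟨2, 4, 0b00101, 0b11000⟩,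
   ⟨2, 4, 0b00110, 0b11000⟩, ⟨1, 4, 0b01010, 0b10100⟩, ⟨1, 4, 0b01110, 0b10000⟩,
   ⟨4, 2, 0b10001, 0b01100⟩, ⟨4, 2, 0b10010, 0b01100⟩, ⟨3, 4, 0b01001, 0b10100⟩,
   ⟨3, 4, 0b01010, 0b10100⟩, ⟨4, 3, 0b10001, 0b01100⟩, ⟨3, 4, 0b01110, 0b10000⟩],
  [⟨3, 1, 0b11001, 0b00010⟩, ⟨1, 3, 0b00010, 0b11100⟩, ⟨1, 3, 0b10010, 0b01100⟩,
   ⟨3, 2, 0b01001, 0b10100⟩, ⟨3, 2, 0b01010, 0b10100⟩, ⟨0, 4, 0b00001, 0b11010⟩,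
   ⟨0, 4, 0b00011, 0b11000⟩, ⟨3, 4, 0b01011, 0b10000⟩, ⟨4, 3, 0b10101, 0b01000⟩,
   ⟨3, 4, 0b01110, 0b10000⟩],
  [⟨0, 2, 0b10001, 0b00110⟩, ⟨1, 2, 0b10011, 0b00100⟩, ⟨0, 2, 0b10001, 0b01100⟩,
   ⟨3, 2, 0b11001, 0b00100⟩, ⟨2, 3, 0b00101, 0b11000⟩, ⟨2, 3, 0b00110, 0b11000⟩,
   ⟨2, 4, 0b00101, 0b10010⟩, ⟨4, 2, 0b10001, 0b00110⟩, ⟨2, 4, 0b00101, 0b11000⟩,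
   ⟨2, 4, 0b00110, 0b11000⟩, ⟨4, 2, 0b10001, 0b01100⟩, ⟨3, 4, 0b01101, 0b10000⟩,
   ⟨4, 3, 0b10010, 0b01100⟩],
  [⟨0, 2, 0b01011, 0b00100⟩, ⟨2, 3, 0b00101, 0b01010⟩, ⟨0, 2, 0b11001, 0b00100⟩,
   ⟨1, 3, 0b00010, 0b11100⟩, ⟨3, 2, 0b11001, 0b00100⟩, ⟨0, 4, 0b00001, 0b11100⟩,
   ⟨3, 4, 0b01101, 0b10000⟩],
  [⟨0, 2, 0b11001, 0b00100⟩, ⟨1, 2, 0b11010, 0b00100⟩, ⟨1, 2, 0b10010, 0b01100⟩,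
   ⟨2, 3, 0b00101, 0b11000⟩, ⟨2, 3, 0b00110, 0b11000⟩, ⟨0, 4, 0b00101, 0b10010⟩,
   ⟨2, 4, 0b00111, 0b10000⟩, ⟨0, 4, 0b00101, 0b11000⟩, ⟨4, 2, 0b11001, 0b00100⟩,
   ⟨0, 4, 0b01101, 0b10000⟩, ⟨2, 4, 0b01101, 0b10000⟩, ⟨2, 4, 0b01110, 0b10000⟩],
  [⟨3, 1, 0b11001, 0b00010⟩, ⟨1, 3, 0b00110, 0b11000⟩, ⟨0, 3, 0b10101, 0b01000⟩,
   ⟨1, 3, 0b10110, 0b01000⟩, ⟨1, 3, 0b10010, 0b01100⟩, ⟨3, 2, 0b01001, 0b10100⟩,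
   ⟨3, 2, 0b01010, 0b10100⟩, ⟨3, 4, 0b01001, 0b10010⟩, ⟨4, 3, 0b10001, 0b01010⟩,
   ⟨3, 4, 0b01001, 0b10100⟩, ⟨3, 4, 0b01010, 0b10100⟩, ⟨4, 3, 0b10001, 0b01100⟩,
   ⟨4, 3, 0b10010, 0b01100⟩]]

/-- The permutations of `Fin 5`, each given by the decimal digits of a number. -/
def permCodes : List ℕ := [
  1234, 1243, 1324, 1342, 1423, 1432, 2134, 2143, 2314, 2341, 2413, 2431, 3124, 3142, 3214, 3241,
  3412, 3421, 4123, 4132, 4213, 4231, 4312, 4321, 10234, 10243, 10324, 10342, 10423, 10432, 12034,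
  12043, 12304, 12340, 12403, 12430, 13024, 13042, 13204, 13240, 13402, 13420, 14023, 14032, 14203,
  14230, 14302, 14320, 20134, 20143, 20314, 20341, 20413, 20431, 21034, 21043, 21304, 21340, 21403,
  21430, 23014, 23041, 23104, 23140, 23401, 23410, 24013, 24031, 24103, 24130, 24301, 24310, 30124,
  30142, 30214, 30241, 30412, 30421, 31024, 31042, 31204, 31240, 31402, 31420, 32014, 32041, 32104,
  32140, 32401, 32410, 34012, 34021, 34102, 34120, 34201, 34210, 40123, 40132, 40213, 40231, 40312,
  40321, 41023, 41032, 41203, 41230, 41302, 41320, 42013, 42031, 42103, 42130, 42301, 42310, 43012,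
  43021, 43102, 43120, 43201, 43210]

/-- The transpositions of `Fin 5`, in the same encoding. -/
def transpositionCodes : List ℕ :=
  [10234, 21034, 31204, 41230, 2134, 3214, 4231, 1324, 1432, 1243]

/-- For each family and each transposition, a number `10 ^ 5 * t + p` such that the step of
`Config.rungStep` leads to family `t` with lines renamed by `p`. -/
def rungCertificates : List (List ℕ) := [
  [1234, 120341, 1234, 140123, 213240, 341230, 1234, 1234, 121430, 303142],
  [101234, 101234, 401234, 201432, 101234, 501234, 101234, 610342, 641032, 101234],
  [201234, 201234, 201234, 101432, 201234, 701234, 201234, 201234, 801234, 101234],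
  [301234, 301234, 231024, 631024, 213204, 301234, 301234, 301234, 613204, 301234],
  [401234, 210243, 401234, 210423, 401234, 931204, 401234, 1234, 1001234, 1432],
  [501234, 501234, 1101234, 1101243, 531420, 501234, 501234, 301234, 301243, 501234],
  [601234, 1201234, 601234, 601234, 601234, 110324, 601234, 110423, 601234, 310243],
  [701234, 701234, 701234, 501432, 701234, 701234, 513402, 701234, 520413, 531402],
  [801234, 801234, 801234, 1201432, 801234, 520413, 801234, 310423, 801234, 1042130],
  [901234, 501234, 901234, 901234, 510234, 901234, 901234, 531204, 214032, 713042],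
  [1001234, 602431, 1001234, 210423, 1001234, 214302, 1001234, 1234, 1001234, 441230],
  [1101234, 501234, 1101234, 701342, 530412, 1101234, 1101234, 510432, 641023, 1101234],
  [1201234, 1201234, 501324, 1201234, 1201234, 510324, 1201234, 520314, 1201234, 204213]]

/-- For each family and each permutation, a number `10 ^ 5 * t + p` such that the step of
`Config.blockStep` leads to family `t` with lines renamed by `p`. -/
def blockCertificates : List (List ℕ) := [
  [1234, 303142, 1234, 301243, 301342, 121430, 213240, 101234, 1012403, 101234, 812304, 1001234,
   213240, 313240, 341230, 301342, 101324, 101324, 1234, 301324, 301234, 1234, 1234, 1234, 1234,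
   101234, 1234, 601234, 101234, 601234, 1201243, 101234, 201234, 601234, 301243, 601234, 701234,
   301243, 201324, 1101243, 101324, 301234, 101234, 1234, 1234, 101423, 1234, 601243, 701234,
   101234, 701234, 1234, 301234, 201234, 102341, 101234, 1324, 601243, 101234, 1001342, 701234,
   101234, 701234, 201342, 201234, 301234, 301234, 201234, 101234, 301423, 201234, 601243, 1234,
   601234, 1001243, 1234, 1243, 1234, 102341, 601234, 1234, 401243, 601234, 1234, 701234, 201234,
   401234, 601234, 601234, 201243, 701234, 201234, 201234, 601234, 1234, 901234, 1101243, 601234,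
   1101243, 104123, 601234, 101423, 101234, 601234, 601324, 104123, 1234, 101423, 101243, 602134,
   101234, 601234, 1234, 601234, 301234, 101234, 701234, 901234, 901243, 401243],
  [101234, 101234, 202143, 801243, 1001234, 621034, 101234, 101234, 301234, 101234, 201243, 1201234,
   302134, 101234, 501234, 501234, 1243, 912034, 1234, 1201234, 501234, 101234, 912034, 1234,
   101234, 101234, 1234, 1234, 601234, 1201234, 101234, 101234, 201234, 101234, 601234, 601234,
   301234, 101234, 510234, 101243, 601234, 301423, 1234, 1201234, 101234, 601234, 301324, 601243,
   101234, 101234, 301234, 101234, 301234, 101234, 101234, 101234, 201234, 101234, 101234, 601234,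
   301234, 301234, 203124, 101234, 901234, 901234, 301234, 101234, 101234, 601234, 1234, 901234,
   1234, 101234, 503214, 101234, 1243, 301324, 201234, 101234, 401234, 401234, 601234, 324301,
   301234, 101234, 201234, 201234, 601234, 3241, 301243, 1234, 601234, 601243, 1234, 901234, 601234,
   1201234, 601324, 1201432, 301423, 101423, 1234, 1201234, 901342, 201432, 304321, 101423, 301234,
   101234, 601234, 601234, 601234, 901234, 1243, 301234, 601234, 601243, 901243, 401243],
  [201234, 101234, 201234, 601234, 301234, 801234, 201234, 101234, 701234, 201234, 331420, 801234,
   701234, 321430, 701234, 903142, 101324, 201234, 101234, 601234, 1201342, 201234, 101324, 201234,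
   201234, 101234, 201234, 601234, 101234, 601234, 201234, 101234, 201234, 601234, 301342, 1201234,
   701234, 103124, 603142, 301432, 101324, 601243, 101234, 601234, 101234, 101432, 601234, 601243,
   201234, 101234, 701234, 201234, 101243, 201234, 201234, 101234, 201234, 601243, 101234, 101432,
   701234, 1102134, 701234, 301432, 201234, 601243, 701234, 201234, 101234, 101432, 201234, 601243,
   201234, 601234, 701234, 301234, 1243, 1234, 201234, 601234, 201234, 801342, 601234, 101423,
   701234, 201234, 201234, 601234, 601234, 201243, 101324, 201234, 601234, 601243, 201234, 601243,
   1101243, 601234, 331402, 110432, 1243, 101423, 101234, 601234, 101234, 101432, 601234, 101423,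
   101243, 201234, 101234, 1201234, 1234, 201243, 101324, 201234, 101342, 601243, 201324, 601243],
  [301234, 301234, 301234, 301324, 301243, 812304, 213204, 213204, 221304, 302143, 621304, 302134,
   213204, 812304, 301234, 301234, 912043, 302134, 301432, 301432, 301234, 301234, 301324, 301234,
   301234, 301234, 1234, 301324, 301243, 302134, 203214, 101234, 201234, 201234, 102134, 304123,
   301234, 301243, 203124, 501234, 601234, 601234, 101234, 301234, 301234, 104123, 1234, 601243,
   203124, 101234, 201234, 1234, 301234, 301234, 301234, 301234, 201234, 1234, 301234, 1101243,
   301234, 301234, 203124, 101243, 701234, 901234, 301234, 301234, 101234, 201342, 201234, 601234,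
   701234, 101342, 201324, 201324, 101324, 301324, 201324, 101324, 201324, 203142, 101324, 323401,
   221304, 201234, 701234, 701234, 902134, 303421, 901234, 1234, 701234, 601243, 201324, 203142,
   601234, 301423, 401243, 101423, 301423, 101423, 301234, 912034, 601324, 101423, 324301, 101423,
   701234, 301234, 1201234, 601243, 204231, 601243, 1243, 301234, 321403, 201243, 603124, 401243],
  [401234, 1342, 1234, 1342, 1234, 1001234, 401234, 101234, 901234, 1234, 1243, 801234, 1234,
   201342, 1101234, 1101234, 101324, 301324, 1234, 601234, 501234, 401234, 301243, 1234, 401234,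
   301234, 1234, 1234, 1234, 601234, 201243, 101234, 201234, 601234, 601234, 1201234, 301234,
   301234, 901234, 601324, 101324, 301234, 101234, 601234, 401234, 201423, 601234, 601243, 402134,
   101234, 301234, 201234, 301234, 101234, 202143, 101234, 102341, 602341, 101234, 101234, 301234,
   101234, 401234, 1342, 1234, 301234, 301234, 101234, 101234, 1201234, 1234, 601243, 1234, 101234,
   901234, 401234, 1243, 1234, 202143, 101234, 401234, 204123, 601234, 1234, 301234, 101234, 401234,
   601234, 601234, 1243, 1243, 101234, 601234, 601234, 401234, 901234, 1101243, 601234, 1101243,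
   201423, 901234, 101423, 302143, 601234, 104321, 204123, 101234, 101423, 301234, 201234, 101234,
   1201234, 1234, 901234, 301234, 201234, 201234, 601243, 401234, 901234],
  [501234, 501234, 301234, 301234, 301243, 301243, 531420, 101234, 301234, 301234, 201243, 201243,
   303124, 101234, 501234, 501234, 1243, 1243, 301342, 301342, 501234, 501234, 1234, 1234, 501234,
   501234, 1234, 1234, 601234, 601234, 203124, 101234, 201234, 201234, 601234, 601234, 301234,
   101234, 1101234, 501234, 601234, 601234, 101234, 101243, 501234, 1101243, 1234, 601243, 203124,
   101234, 201234, 1234, 301234, 301234, 501234, 301234, 201234, 1234, 301234, 201243, 301234,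
   301234, 203124, 101234, 701234, 901234, 301234, 301234, 101234, 1342, 1234, 601234, 701234,
   201234, 901234, 401234, 101324, 301324, 301234, 301234, 901234, 901234, 101324, 323401, 301234,
   101234, 401234, 201234, 601234, 3241, 301234, 1234, 201234, 601243, 401234, 901234, 601234,
   601234, 401243, 901243, 301423, 101423, 301234, 301243, 901243, 901243, 324301, 101423, 301234,
   301234, 601234, 601234, 3142, 601243, 1243, 301234, 601234, 601234, 901243, 401243],
  [601234, 310234, 202143, 301432, 301324, 601234, 601234, 201342, 1243, 1342, 101324, 601234, 3142,
   201342, 110324, 201342, 101324, 1234, 3142, 601234, 204132, 601234, 1243, 101423, 601234, 301234,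
   101423, 101234, 1234, 601234, 1201234, 101234, 601234, 1101243, 601234, 601234, 320314, 301234,
   101324, 601324, 101324, 301234, 202143, 1201234, 601234, 601234, 601234, 101423, 1201234, 101234,
   310324, 102143, 201243, 801234, 1201234, 101234, 301324, 332401, 601234, 801234, 310324, 101234,
   301324, 2341, 601234, 201243, 201243, 1201234, 601234, 1201234, 301324, 102413, 601234, 101234,
   110324, 1342, 1243, 1234, 1201234, 101234, 601234, 201342, 601234, 1234, 102431, 101234, 601234,
   1342, 601234, 1243, 201243, 1201234, 601234, 601234, 601234, 201423, 301432, 601234, 1101243,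
   601234, 901234, 101423, 320341, 1201234, 201432, 601234, 101234, 101423, 601324, 1201234, 201342,
   601234, 101234, 901234, 201243, 202143, 201234, 601243, 401234, 901234],
  [701234, 530412, 701234, 202134, 102134, 820143, 701234, 101234, 701234, 201234, 101234, 102314,
   701234, 101324, 701234, 310432, 101324, 201234, 101234, 101342, 330412, 510432, 101324, 201234,
   701234, 203124, 701234, 101324, 101234, 101324, 701234, 101234, 701234, 601243, 101234, 601243,
   701234, 101324, 701234, 601243, 101324, 601243, 101234, 101324, 830142, 301432, 101324, 601243,
   701234, 101234, 701234, 201234, 101234, 201234, 701234, 101234, 701234, 601243, 101234, 301423,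
   701234, 201234, 701234, 601243, 201234, 601243, 101234, 201234, 101234, 601243, 201234, 601243,
   701234, 101324, 701234, 810342, 101324, 201234, 701234, 101324, 701234, 801342, 101324, 601243,
   701234, 201234, 701234, 601243, 201234, 601243, 101324, 201234, 101324, 601243, 201324, 601243,
   101234, 101342, 203124, 201324, 101324, 201234, 101234, 110324, 203124, 501432, 101324, 601243,
   101234, 201234, 101234, 601243, 201234, 601243, 101324, 201234, 101324, 601243, 201324, 601243],
  [801234, 1032140, 310423, 303124, 302143, 801234, 801234, 101234, 202134, 202341, 201243, 801234,
   201234, 201342, 520413, 2431, 101324, 201234, 201234, 601234, 301243, 801234, 101324, 201234,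
   801234, 101234, 1234, 101234, 1234, 601234, 801234, 101234, 801234, 204123, 601234, 1201234,
   701234, 301234, 202134, 331402, 101324, 601243, 201234, 601234, 601234, 1201234, 601234, 601243,
   201234, 101234, 701234, 301234, 301234, 201234, 801234, 101234, 301324, 332401, 401234, 1201234,
   701234, 101234, 201234, 204123, 1234, 201243, 301234, 201234, 101234, 1201234, 1234, 801243,
   1234, 101234, 202134, 101234, 1243, 1234, 310423, 101234, 801234, 602341, 601234, 101423, 202134,
   101234, 801234, 1201234, 601234, 201243, 1243, 201234, 601234, 101423, 601234, 201243, 203412,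
   601234, 310342, 1201234, 1243, 101423, 320341, 1201234, 301342, 1201432, 601234, 101423, 203421,
   1201234, 301342, 1201234, 601234, 201243, 1243, 2143, 601234, 101423, 601234, 201243],
  [901234, 713042, 521304, 212043, 212034, 212034, 510234, 201342, 501423, 101423, 101324, 601234,
   503412, 201342, 901234, 1201324, 101324, 1234, 201342, 601234, 1201324, 901234, 1243, 101423,
   901234, 1201324, 320314, 601234, 701234, 101324, 301234, 301234, 201234, 101423, 101324, 1243,
   301234, 301234, 901234, 601324, 101324, 301234, 301234, 301234, 1101234, 901234, 1234, 101423,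
   503412, 201342, 501423, 101423, 101324, 601234, 501234, 301234, 201234, 101423, 101324, 1243,
   301234, 101234, 401234, 1342, 601234, 1243, 301234, 101234, 201342, 601234, 1234, 601243, 503412,
   201342, 901234, 1201324, 101324, 1234, 301234, 301234, 901234, 601324, 101324, 301234, 301234,
   101234, 401234, 1342, 601234, 1243, 301234, 101234, 201234, 601234, 401234, 901234, 201342,
   601234, 1201324, 901234, 601234, 101423, 301234, 301243, 1101234, 901234, 1234, 101423, 301234,
   101234, 201342, 601234, 1234, 601243, 301234, 101234, 201234, 601234, 401234, 901234],
  [1001234, 431042, 1234, 1342, 1234, 1001234, 1001234, 101234, 304132, 101234, 301243, 1001234,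
   304321, 301342, 214302, 1013024, 212304, 301324, 1234, 1001234, 214302, 1001234, 301243, 1234,
   1001234, 601324, 1234, 101234, 1234, 601234, 301243, 101234, 201243, 1101243, 601234, 1201234,
   301234, 301234, 101324, 601324, 101324, 301234, 201234, 601234, 1001234, 201423, 601234, 601243,
   201234, 101234, 301234, 301234, 301234, 201234, 602431, 101234, 202143, 332401, 101234, 1201234,
   301234, 101234, 201234, 2341, 1234, 301234, 301234, 201234, 101234, 1201234, 1234, 801243, 1234,
   101234, 204132, 1001243, 1243, 1234, 202143, 101234, 1001234, 1001243, 601234, 1234, 201243,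
   101234, 601234, 601234, 601234, 1243, 1243, 101234, 601234, 601234, 601234, 201423, 301432,
   601234, 601324, 204123, 901234, 101423, 320341, 601234, 204123, 204123, 101234, 101423, 601324,
   1201234, 101234, 1201234, 101234, 901234, 901234, 2143, 201234, 601243, 401234, 901234],
  [1101234, 1101234, 510423, 1234, 1243, 212304, 530412, 101234, 201234, 1234, 1243, 202134, 203124,
   201342, 1101234, 1101234, 101324, 101324, 101234, 301342, 501234, 1101234, 1234, 1234, 1101234,
   501234, 201234, 1234, 601234, 101324, 501234, 101234, 201234, 601243, 601234, 101342, 301234,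
   301234, 1101234, 1201324, 101324, 101324, 101234, 101243, 501234, 201342, 1234, 601243, 203124,
   101234, 201234, 1234, 301234, 701234, 501234, 301234, 201234, 101423, 301234, 901243, 301234,
   301234, 203124, 201342, 701234, 701234, 301234, 301234, 101234, 201342, 1234, 101423, 401234,
   201234, 901234, 401234, 101324, 601234, 301234, 301234, 901234, 901234, 101324, 101324, 301234,
   101234, 401234, 601234, 601234, 101324, 301234, 101234, 201234, 601234, 401234, 901234, 1342,
   104312, 1101243, 1201324, 101423, 101423, 301234, 301243, 1101243, 701342, 101423, 101423,
   301234, 301234, 1342, 201342, 101423, 101423, 301234, 301234, 201342, 201342, 1201324, 1201324],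
  [1201234, 203214, 520314, 102134, 202413, 1201234, 1201234, 101234, 310324, 101234, 201243,
   1201234, 320314, 101234, 510324, 101234, 201243, 101423, 101423, 1201234, 201243, 1201234,
   201243, 101423, 1201234, 101234, 202143, 101234, 101423, 1201234, 1201234, 101234, 801234,
   101234, 601234, 1201234, 320314, 101234, 501324, 101243, 601234, 101423, 101423, 1201234, 601234,
   1201234, 601234, 101423, 1201234, 101234, 810234, 101234, 201243, 1201234, 1201234, 101234,
   801234, 101234, 601234, 1201234, 310324, 101234, 301324, 101234, 601234, 201243, 201243, 1201234,
   601234, 1201234, 601234, 201243, 202143, 101234, 810234, 101234, 201243, 101423, 320314, 101234,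
   801234, 101234, 601234, 101423, 310324, 101234, 801234, 101234, 601234, 201243, 201243, 101423,
   601234, 101423, 601234, 201243, 101423, 1201234, 104213, 1201234, 201243, 101423, 101423,
   1201234, 301342, 1201234, 601234, 101423, 201243, 1201234, 601234, 1201234, 601234, 201243,
   201243, 101423, 601234, 101423, 601234, 201243]]

/-- Every configuration of family `n / 10 ^ 5`, with lines renamed by the last five digits of `n`,
is reached by `step`, up to `Config.swap`, from a configuration in `S`. -/
def leads (step : Config → ℕ → Config → Bool) (S : List Config) (n : ℕ) : Bool :=
  ([0, 1, 2, 3, 4].all fun i => [0, 1, 2, 3, 4].any fun j => Nat.beq (digit n j) i) &&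
  match stateTable[n / 100000]? with
  | none => false
  | some T => T.all fun d => S.any fun c => step c n d || step c n d.swap

/-- The certificates in a table are valid for all families and all maps in `codes`. -/
def validTable (step : ℕ → Config → ℕ → Config → Bool) (codes : List ℕ) (table : List (List ℕ)) :
    Bool :=
  (List.zip stateTable table).all fun x =>
    (List.zip codes x.2).all fun y => leads (step y.1) x.1 y.2

lemma stateTable_proper : (stateTable.all fun S => S.all Config.proper) = true := by decide +kernel

lemma rung_certified : validTable Config.rungStep transpositionCodes rungCertificates = true := by
  decide +kernel

lemma block_certified : validTable Config.blockStep permCodes blockCertificates = true := by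
  decide +kernel

/-! ### Soundness of the automaton -/

lemma digit_lt (n i : ℕ) : digit n i < 5 := Nat.mod_lt _ (by norm_num)

/-- The number encoding a map from `Fin 5` to itself. -/
def encode (σ : Fin 5 → Fin 5) : ℕ :=
  10000 * σ 0 + 1000 * σ 1 + 100 * σ 2 + 10 * σ 3 + σ 4

lemma digit_encode (σ : Fin 5 → Fin 5) (i : Fin 5) : digit (encode σ) i = σ i := by
  have h0 := (σ 0).isLt
  have h1 := (σ 1).isLt
  have h2 := (σ 2).isLt
  have h3 := (σ 3).isLt
  have h4 := (σ 4).isLt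
  have e : ∀ k, digit (encode σ) k = encode σ / 10 ^ (4 - k) % 5 := fun _ => rfl
  rw [e]
  fin_cases i <;> simp [encode] <;> omega

lemma encode_mem_permCodes (σ : Equiv.Perm (Fin 5)) : encode σ ∈ permCodes := by
  revert σ; decide +kernel

lemma encode_swap_mem (i j : Fin 5) (h : i ≠ j) :
    encode (Equiv.swap i j) ∈ transpositionCodes := by
  revert i j; decide +kernel

variable {V : Type*} {G : SimpleGraph V} {X Y : Set V}

namespace Config

/-- `Linkage.Realized` for a configuration in numerical form. -/
def Realized (c : Config) (L : Linkage G X Y (Fin 5)) (r : Fin 5 → ℕ) : Prop :=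
  L.Realized r (Fin.ofNat 5 c.a) (Fin.ofNat 5 c.b) {i | bit c.A i = true} {i | bit c.B i = true}

lemma Realized.swap {c : Config} {L : Linkage G X Y (Fin 5)} {r : Fin 5 → ℕ}
    (h : c.Realized L r) : c.swap.Realized L r := Linkage.Realized.swap h

lemma exists_fin {c : Config} (hc : c.proper = true) :
    ∃ a b : Fin 5, c.a = a ∧ c.b = b ∧ Fin.ofNat 5 c.a = a ∧ Fin.ofNat 5 c.b = b ∧
      bit c.A a = true ∧ bit c.B b = true ∧ bit c.B a = false ∧ bit c.A b = false := by
  simp only [proper, Bool.and_eq_true, Bool.not_eq_true'] at hc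
  obtain ⟨⟨⟨⟨⟨h1, h2⟩, h3⟩, h4⟩, h5⟩, h6⟩ := hc
  have h1 : c.a < 5 := by simpa [Nat.blt] using h1
  have h2 : c.b < 5 := by simpa [Nat.blt] using h2
  exact ⟨⟨c.a, h1⟩, ⟨c.b, h2⟩, rfl, rfl, Fin.ext (Nat.mod_eq_of_lt h1),
    Fin.ext (Nat.mod_eq_of_lt h2), h3, h4, h5, h6⟩

lemma proper_swap {c : Config} (hc : c.proper = true) : c.swap.proper = true := by
  simp only [proper, swap, Bool.and_eq_true, Bool.not_eq_true'] at *
  tauto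

lemma stays_iff {s : ℕ} {σ : Equiv.Perm (Fin 5)} (hσ : ∀ i : Fin 5, digit s i = σ i)
    (x q : Fin 5) : stays s x q = true ↔ q = x ∨ q = σ x := by
  simp [stays, hσ, Fin.ext_iff]

lemma all_five {f : ℕ → Bool} (h : [0, 1, 2, 3, 4].all f = true) (k : Fin 5) : f k = true :=
  List.all_eq_true.1 h _ (by fin_cases k <;> simp)

lemma beq_fin (x y : Fin 5) : Nat.beq x y = decide (x = y) := by
  rw [Bool.eq_iff_iff, Nat.beq_eq]
  simp [Fin.ext_iff]

/-- How the condition on the marks in `rungStep` and `blockStep` translates into the hypotheses of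
`Linkage.Realized.rung` and `Linkage.Realized.block`. -/
lemma mark_sound {m : Bool} {k : Fin 5} {σ : Equiv.Perm (Fin 5)} {P Q : Prop} {u v : Bool}
    (h : (m || !bif decide (σ k = k) then u else v) = true) (hu : P → u = true) (hv : Q → v = true)
    (hk : if σ k = k then P else Q) : m = true := by
  by_cases hs : σ k = k
  · rw [if_pos hs] at hk; simpa [hs, hu hk] using h
  · rw [if_neg hs] at hk; simpa [hs, hv hk] using h

lemma rungStep_sound {s n : ℕ} {σ p : Equiv.Perm (Fin 5)} (hσ : ∀ i : Fin 5, digit s i = σ i)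
    (hp : ∀ i : Fin 5, digit n i = p i) {c d : Config} (hc : c.proper = true)
    (hd : d.proper = true) (h : rungStep s c n d = true) {L : Linkage G X Y (Fin 5)}
    {r : Fin 5 → ℕ} (hr : L.IsFrontier r)
    (hoff : ∀ k, σ k ≠ k → L.Off (k, r k) (σ k, r (σ k)))
    (hσ2 : ∀ k l, σ k ≠ k → σ l ≠ l → l = k ∨ l = σ k) (hreal : c.Realized L r) :
    d.Realized (L.reindex p) ((fun k => if σ k = k then r k else r k + 1) ∘ p) := by
  obtain ⟨a, b, ha, hb, ha', hb', hAa, hBb, hBa, hAb⟩ := exists_fin hc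
  obtain ⟨x, y, hx, hy, hx', hy', -⟩ := exists_fin hd
  simp only [rungStep, ha, hb, hx, hy, hp, Bool.and_eq_true, Bool.not_eq_true',
    ← Bool.not_eq_true, stays_iff hσ] at h
  obtain ⟨h1, h2, h3, h4, h5, h6⟩ := h
  rw [not_or] at h3
  rw [Realized, ha', hb'] at hreal
  rw [Realized, hx', hy']
  refine (hreal.rung hr σ hoff hσ2 (a' := p x) (b' := p y)
    (A' := {k | bit d.A (p.symm k) = true}) (B' := {k | bit d.B (p.symm k) = true}) h1 h2 h3.1 h3.2
    (by simp [hBa]) h4 (by simp [hAb]) h5 ?_ ?_).reindex (fun i hi => ?_) (fun i hi => ?_)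
  · intro k hk
    obtain ⟨k, rfl⟩ := p.surjective k
    have hm := all_five h6 k
    simp only [hp, hσ, beq_fin, Bool.and_eq_true] at hm
    change bit d.A (p.symm (p k)) = true
    rw [Equiv.symm_apply_apply]
    refine mark_sound hm.1 id (fun hQ => ?_) hk
    simpa using hQ
  · intro k hk
    obtain ⟨k, rfl⟩ := p.surjective k
    have hm := all_five h6 k
    simp only [hp, hσ, beq_fin, Bool.and_eq_true] at hm
    change bit d.B (p.symm (p k)) = true
    rw [Equiv.symm_apply_apply]
    refine mark_sound hm.2 id (fun hQ => ?_) hk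
    simpa using hQ
  · change bit d.A (p.symm (p i)) = true at hi
    rwa [Equiv.symm_apply_apply] at hi
  · change bit d.B (p.symm (p i)) = true at hi
    rwa [Equiv.symm_apply_apply] at hi

lemma blockStep_sound {s n : ℕ} {σ p : Equiv.Perm (Fin 5)} (hσ : ∀ i : Fin 5, digit s i = σ i)
    (hp : ∀ i : Fin 5, digit n i = p i) {c d : Config} (hc : c.proper = true)
    (hd : d.proper = true) (h : blockStep s c n d = true) {L : Linkage G X Y (Fin 5)}
    {r : Fin 5 → ℕ} (hr : L.IsFrontier r)
    (hoff : ∀ k, σ k ≠ k → L.Off (k, r k) (σ k, r (σ k) + 1)) (hreal : c.Realized L r) :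
    d.Realized (L.reindex p) ((fun k => if σ k = k then r k else r k + 2) ∘ p) := by
  obtain ⟨a, b, ha, hb, ha', hb', hAa, hBb, hBa, hAb⟩ := exists_fin hc
  obtain ⟨x, y, hx, hy, hx', hy', -⟩ := exists_fin hd
  simp only [blockStep, ha, hb, hx, hy, hp, Bool.and_eq_true, Bool.not_eq_true',
    ← Bool.not_eq_true, stays_iff hσ] at h
  obtain ⟨h1, h2, h3, h4, h5⟩ := h
  rw [not_or] at h3 h4
  rw [Realized, ha', hb'] at hreal
  rw [Realized, hx', hy']
  refine (hreal.block hr σ hoff (a' := p x) (b' := p y)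
    (A' := {k | bit d.A (p.symm k) = true}) (B' := {k | bit d.B (p.symm k) = true}) h1 h2 h3.1 h3.2
    h4.1 h4.2 (by simp [hBa]) (by simp [hAb]) ?_ ?_).reindex (fun i hi => ?_) (fun i hi => ?_)
  · intro k hk
    obtain ⟨k, rfl⟩ := p.surjective k
    have hm := all_five h5 k
    simp only [hp, hσ, beq_fin, Bool.and_eq_true] at hm
    change bit d.A (p.symm (p k)) = true
    rw [Equiv.symm_apply_apply]
    refine mark_sound hm.1 id (fun hQ => ?_) hk
    simpa using hQ
  · intro k hk
    obtain ⟨k, rfl⟩ := p.surjective k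
    have hm := all_five h5 k
    simp only [hp, hσ, beq_fin, Bool.and_eq_true] at hm
    change bit d.B (p.symm (p k)) = true
    rw [Equiv.symm_apply_apply]
    refine mark_sound hm.2 id (fun hQ => ?_) hk
    simpa using hQ
  · change bit d.A (p.symm (p i)) = true at hi
    rwa [Equiv.symm_apply_apply] at hi
  · change bit d.B (p.symm (p i)) = true at hi
    rwa [Equiv.symm_apply_apply] at hi

lemma clear_sound {c : Config} (hc : c.proper = true) {L : Linkage G X Y (Fin 5)}
    {r : Fin 5 → ℕ} (hr : L.IsFrontier r) {i : Fin 5} (hi : r i ≤ L.len i) (h : c.Realized L r) :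
    c.Realized L (fun k => if k = i then r k + 1 else r k) := by
  obtain ⟨a, b, -, -, ha', hb', hAa, hBb, hBa, hAb⟩ := exists_fin hc
  rw [Realized, ha', hb'] at h ⊢
  exact h.clear hr hAa hBb (by simp [hBa]) (by simp [hAb]) hi

end Config

lemma exists_zip_of_mem_left {α β : Type*} {l : List α} {l' : List β}
    (h : l.length = l'.length) {x : α} (hx : x ∈ l) : ∃ y, (x, y) ∈ l.zip l' := by
  obtain ⟨i, hi, rfl⟩ := List.mem_iff_getElem.1 hx
  exact ⟨l'[i], List.mem_iff_getElem.2 ⟨i, by simpa [h] using h ▸ hi, by simp⟩⟩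

lemma stateTable_proper_of_mem {S : List Config} (hS : S ∈ stateTable) {c : Config} (hc : c ∈ S) :
    c.proper = true :=
  List.all_eq_true.1 (List.all_eq_true.1 stateTable_proper S hS) c hc

/-- A valid certificate provides the renaming of the lines and the family that is reached. -/
lemma exists_of_leads {step : Config → ℕ → Config → Bool} {S : List Config} {n : ℕ}
    (h : leads step S n = true) : ∃ p : Equiv.Perm (Fin 5), (∀ i : Fin 5, digit n i = p i) ∧
      ∃ T ∈ stateTable, ∀ d ∈ T, ∃ c ∈ S, step c n d = true ∨ step c n d.swap = true := by
  rw [leads, Bool.and_eq_true] at h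
  obtain ⟨h1, h2⟩ := h
  let f : Fin 5 → Fin 5 := fun i => ⟨digit n i, digit_lt n i⟩
  have hf : Function.Surjective f := by
    intro i
    have h3 := Config.all_five h1 i
    rw [List.any_eq_true] at h3
    obtain ⟨j, hj, h4⟩ := h3
    have hj5 : j < 5 := by simp at hj; omega
    exact ⟨⟨j, hj5⟩, Fin.ext (by simpa [Nat.beq_eq] using h4)⟩
  refine ⟨Equiv.ofBijective f (Finite.surjective_iff_bijective.1 hf), fun i => rfl, ?_⟩
  split at h2
  · exact absurd h2 (by simp)
  · next T hT =>
    refine ⟨T, List.mem_of_getElem? hT, fun d hd => ?_⟩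
    simpa using List.all_eq_true.1 h2 d hd

lemma exists_certificate {step : ℕ → Config → ℕ → Config → Bool} {codes : List ℕ}
    {table : List (List ℕ)} (hl : stateTable.length = table.length)
    (hl' : table.all (fun x => x.length == codes.length) = true)
    (h : validTable step codes table = true) {S : List Config} (hS : S ∈ stateTable) {s : ℕ}
    (hs : s ∈ codes) : ∃ n, leads (step s) S n = true := by
  obtain ⟨t, ht⟩ := exists_zip_of_mem_left hl hS
  have h1 := List.all_eq_true.1 h _ ht
  have h2 := List.all_eq_true.1 hl' t (List.of_mem_zip ht).2
  obtain ⟨n, hn⟩ := exists_zip_of_mem_left (l' := t) (by simpa using (beq_iff_eq.1 h2).symm) hs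
  exact ⟨n, List.all_eq_true.1 h1 _ hn⟩

/-- In a minimal family of five lines, the configurations of some family in `stateTable` remain
realized, up to renaming the lines, until everything is processed. -/
theorem exists_nonAdjacent_of_realized (m : ℕ) (L : Linkage G X Y (Fin 5)) (hL : L.IsMinimal)
    (r : Fin 5 → ℕ) (hr : L.IsFrontier r) (hm : ∑ i, (L.len i + 1 - r i) = m) (S : List Config)
    (hS : S ∈ stateTable) (hreal : ∀ c ∈ S, c.Realized L r) :
    ∃ P Q : G.XYPath X Y, P.NonAdjacent Q := by
  induction m using Nat.strong_induction_on generalizing L r S with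
  | _ m ih =>
  subst hm
  by_cases hfin : ∀ i, r i = L.len i + 1
  · have hne : ∀ S ∈ stateTable, S ≠ [] := by decide
    obtain ⟨c, hc⟩ := List.exists_mem_of_ne_nil S (hne S hS)
    exact (hreal c hc).exists_nonAdjacent hfin
  push Not at hfin
  obtain ⟨i₀, hi₀⟩ := hfin
  have hi₀ : r i₀ ≤ L.len i₀ := by have := hr.le i₀; omega
  have hlt : ∀ r' : Fin 5 → ℕ, L.IsFrontier r' → (∀ k, r k ≤ r' k) → (∃ k, r k < r' k) →
      ∑ i, (L.len i + 1 - r' i) < ∑ i, (L.len i + 1 - r i) := by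
    rintro r' hr' hle ⟨k, hk⟩
    refine Finset.sum_lt_sum (fun i _ => by have := hle i; omega) ⟨k, Finset.mem_univ k, ?_⟩
    have := hr'.le k
    omega
  have hre : ∀ (r' : Fin 5 → ℕ) (p : Equiv.Perm (Fin 5)),
      ∑ i, ((L.reindex p).len i + 1 - (r' ∘ p) i) = ∑ i, (L.len i + 1 - r' i) :=
    fun r' p => Equiv.sum_comp p (fun i => L.len i + 1 - r' i)
  rcases hL.exists_next hr hi₀ with ⟨i, hi, hoff⟩ | ⟨i, j, hij, hoff⟩ | ⟨σ, ⟨k₀, hk₀⟩, hoff⟩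
  · have hr' := hr.clear hi hoff
    refine ih _ (hlt _ hr' (fun k => ?_) ⟨i, by simp⟩) L hL _ hr' rfl S hS fun c hc => ?_
    · split_ifs <;> omega
    · exact Config.clear_sound (stateTable_proper_of_mem hS hc) hr hi (hreal c hc)
  · have hoff' : ∀ k, Equiv.swap i j k ≠ k →
        L.Off (k, r k) (Equiv.swap i j k, r (Equiv.swap i j k)) := by
      intro k hk
      rcases Equiv.swap_apply_ne_self_iff.1 hk with ⟨-, rfl | rfl⟩
      · rw [Equiv.swap_apply_left]; exact hoff
      · rw [Equiv.swap_apply_right]; exact hoff.symm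
    have hσ2 : ∀ k l, Equiv.swap i j k ≠ k → Equiv.swap i j l ≠ l →
        l = k ∨ l = Equiv.swap i j k := by
      intro k l hk hl
      rcases Equiv.swap_apply_ne_self_iff.1 hk with ⟨-, rfl | rfl⟩ <;>
      rcases Equiv.swap_apply_ne_self_iff.1 hl with ⟨-, rfl | rfl⟩ <;> simp
    have hr' := hr.rung hoff'
    obtain ⟨n, hn⟩ := exists_certificate rfl (by decide +kernel) rung_certified hS
      (encode_swap_mem i j hij)
    obtain ⟨p, hp, T, hT, hST⟩ := exists_of_leads hn
    refine ih _ ?_ (L.reindex p) (hL.reindex p) _ (hr'.reindex p) rfl T hT fun d hd => ?_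
    · rw [hre]
      refine hlt _ hr' (fun k => ?_) ⟨i, by simp [hij.symm]⟩
      split_ifs <;> omega
    · obtain ⟨c, hc, h | h⟩ := hST d hd
      · exact Config.rungStep_sound (digit_encode _) hp (stateTable_proper_of_mem hS hc)
          (stateTable_proper_of_mem hT hd) h hr hoff' hσ2 (hreal c hc)
      · refine Config.Realized.swap (c := d.swap) ?_
        exact Config.rungStep_sound (digit_encode _) hp (stateTable_proper_of_mem hS hc)
          (Config.proper_swap (stateTable_proper_of_mem hT hd)) h hr hoff' hσ2 (hreal c hc)
  · have hr' := hr.block hoff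
    obtain ⟨n, hn⟩ := exists_certificate rfl (by decide +kernel) block_certified hS
      (encode_mem_permCodes σ)
    obtain ⟨p, hp, T, hT, hST⟩ := exists_of_leads hn
    refine ih _ ?_ (L.reindex p) (hL.reindex p) _ (hr'.reindex p) rfl T hT fun d hd => ?_
    · rw [hre]
      refine hlt _ hr' (fun k => ?_) ⟨k₀, by simp [hk₀]⟩
      split_ifs <;> omega
    · obtain ⟨c, hc, h | h⟩ := hST d hd
      · exact Config.blockStep_sound (digit_encode _) hp (stateTable_proper_of_mem hS hc)
          (stateTable_proper_of_mem hT hd) h hr hoff (hreal c hc)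
      · refine Config.Realized.swap (c := d.swap) ?_
        exact Config.blockStep_sound (digit_encode _) hp (stateTable_proper_of_mem hS hc)
          (Config.proper_swap (stateTable_proper_of_mem hT hd)) h hr hoff (hreal c hc)

theorem exists_nonAdjacent_of_five (𝓟 : Fin 5 → G.XYPath X Y)
    (hd : XYPath.PairwiseDisjoint 𝓟) (ho : XYPath.AtMostOneEdgeOff 𝓟) :
    ∃ P Q : G.XYPath X Y, P.NonAdjacent Q := by
  obtain ⟨L, hL⟩ := Linkage.exists_isMinimal (XYPath.toLinkage 𝓟 hd ho)
  -- any state of the automaton can serve as the initial one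
  exact exists_nonAdjacent_of_realized _ L hL _ L.isFrontier_zero rfl
    (stateTable.head (by decide)) (List.head_mem _) fun c _ => L.realized_zero _ _ _ _

/-! ### Four lines do not suffice -/

lemma bit_eq_testBit (m i : ℕ) : bit m i = m.testBit i := by
  have h : ∀ x y : ℕ, Nat.land x y = x &&& y := fun _ _ => rfl
  have h' : ∀ x y : ℕ, Nat.shiftRight x y = x >>> y := fun _ _ => rfl
  rw [Bool.eq_iff_iff, bit, h, h', Nat.beq_eq, Nat.testBit, Nat.and_comm]
  rcases Nat.mod_two_eq_zero_or_one (m >>> i) with h2 | h2 <;> simp [Nat.one_and_eq_mod_two, h2]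

/-- Vertex `8 * l + h` of `ladderGraph` is the vertex at height `h` of line `l`. Entry `v` of the
list is the vertex joined to `v` by an edge on none of the four lines. -/
def ladderMates : List ℕ :=
  [24, 17, 9, 26, 20, 12, 29, 15, 16, 2, 19, 27, 5, 22, 30, 7,
   8, 1, 25, 10, 4, 28, 13, 31, 0, 18, 3, 11, 21, 6, 14, 23]

/-- The bit mask of the set of neighbours of `v` in `ladderGraph`. -/
def ladderNbrs (v : ℕ) : ℕ :=
  Nat.lor (Nat.shiftLeft 1 (ladderMates.getD v 0)) <|
    Nat.lor (bif Nat.beq (Nat.mod v 8) 7 then 0 else Nat.shiftLeft 1 (v + 1))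
      (bif Nat.beq (Nat.mod v 8) 0 then 0 else Nat.shiftLeft 1 (v - 1))

/-- Four disjoint paths with eight vertices each, together with a perfect matching. -/
def ladderGraph : SimpleGraph (Fin 32) where
  Adj u v := bit (ladderNbrs u) v = true
  symm := ⟨by decide +kernel⟩
  loopless := ⟨by decide +kernel⟩

instance : DecidableRel ladderGraph.Adj := fun u v =>
  inferInstanceAs (Decidable (bit (ladderNbrs u) v = true))

/-- The vertex at height `h` of line `l`. -/
def ladderVertex (l : Fin 4) (h : Fin 8) : Fin 32 := ⟨8 * l + h, by omega⟩

/-- The bottom vertices of the lines. -/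
def ladderBottom : Set (Fin 32) := {v | v.val % 8 = 0}

/-- The top vertices of the lines. -/
def ladderTop : Set (Fin 32) := {v | v.val % 8 = 7}

lemma ladderGraph_adj : ∀ l : Fin 4, ∀ h : Fin 7,
    ladderGraph.Adj (ladderVertex l h.castSucc) (ladderVertex l h.succ) := by decide +kernel

/-- A line of `ladderGraph`. -/
def ladderWalk (l : Fin 4) : ladderGraph.Walk (ladderVertex l 0) (ladderVertex l 7) :=
  .cons (ladderGraph_adj l 0) <| .cons (ladderGraph_adj l 1) <| .cons (ladderGraph_adj l 2) <|
  .cons (ladderGraph_adj l 3) <| .cons (ladderGraph_adj l 4) <| .cons (ladderGraph_adj l 5) <|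
  .cons (ladderGraph_adj l 6) .nil

lemma ladderWalk_support (l : Fin 4) :
    (ladderWalk l).support = (List.finRange 8).map (ladderVertex l) := rfl

lemma ladderVertex_inj : ∀ (l l' : Fin 4) (h h' : Fin 8),
    ladderVertex l h = ladderVertex l' h' → l = l' ∧ h = h' := by decide +kernel

/-- The four lines of `ladderGraph`. -/
def ladderPath (l : Fin 4) : ladderGraph.XYPath ladderBottom ladderTop where
  source := ladderVertex l 0
  target := ladderVertex l 7
  source_mem := by simp [ladderBottom, ladderVertex]
  target_mem := by simp [ladderTop, ladderVertex]
  walk := ladderWalk l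
  isPath := by
    rw [Walk.isPath_def, ladderWalk_support]
    exact (List.nodup_finRange 8).map fun h h' e => (ladderVertex_inj l l h h' e).2

lemma ladderPath_disjoint : XYPath.PairwiseDisjoint ladderPath := by
  intro l l' hl
  rw [Set.disjoint_left]
  intro v hv hv'
  change v ∈ (ladderWalk l).support at hv
  change v ∈ (ladderWalk l').support at hv'
  rw [ladderWalk_support, List.mem_map] at hv hv'
  obtain ⟨h, -, rfl⟩ := hv
  obtain ⟨h', -, e⟩ := hv'
  exact hl (ladderVertex_inj _ _ _ _ e).1.symm

lemma ladderPath_edges (l : Fin 4) (h : Fin 7) :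
    s(ladderVertex l h.castSucc, ladderVertex l h.succ) ∈ (ladderPath l).edges := by
  change _ ∈ (ladderWalk l).edges
  fin_cases h <;> simp [ladderWalk]

lemma ladderPath_off : XYPath.AtMostOneEdgeOff ladderPath := by
  have key : ∀ u v : Fin 32, ladderGraph.Adj u v → v.val = ladderMates.getD u 0 ∨
      ∃ l : Fin 4, ∃ h : Fin 7, (u = ladderVertex l h.castSucc ∧ v = ladderVertex l h.succ) ∨
        (v = ladderVertex l h.castSucc ∧ u = ladderVertex l h.succ) := by decide +kernel
  intro v _
  rw [Set.encard_le_one_iff]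
  have hmate : ∀ e ∈ ladderGraph.incidenceSet v \ ⋃ l, (ladderPath l).edges,
      ∃ x : Fin 32, e = s(v, x) ∧ x.val = ladderMates.getD v 0 := by
    rintro e ⟨⟨he, hv⟩, hne⟩
    obtain ⟨x, rfl⟩ := Sym2.mem_iff_exists.1 hv
    rcases key v x he with h | ⟨l, h, ⟨rfl, rfl⟩ | ⟨rfl, rfl⟩⟩
    · exact ⟨x, rfl, h⟩
    · exact absurd (Set.mem_iUnion.2 ⟨l, ladderPath_edges l h⟩) hne
    · rw [Sym2.eq_swap] at hne
      exact absurd (Set.mem_iUnion.2 ⟨l, ladderPath_edges l h⟩) hne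
  intro e e' he he'
  obtain ⟨x, rfl, hx⟩ := hmate e he
  obtain ⟨y, rfl, hy⟩ := hmate e' he'
  rw [Fin.ext (hx.trans hy.symm)]

/-- The numbers less than `32`. -/
def vertexList : List ℕ :=
  [0, 1, 2, 3, 4, 5, 6, 7, 8, 9, 10, 11, 12, 13, 14, 15,
   16, 17, 18, 19, 20, 21, 22, 23, 24, 25, 26, 27, 28, 29, 30, 31]

/-- Add to the set `R`, for the vertices in increasing order, the neighbours in `al` of each vertex
of the set obtained so far. -/
def ladderGrow (al R : ℕ) : ℕ :=
  vertexList.foldl (fun R v => bif bit R v then Nat.lor R (Nat.land (ladderNbrs v) al) else R) R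

/-- `R` contains the bottom vertices outside `forb`, contains no top vertex, and is closed under
adjacency outside `forb`. -/
def ladderSeparates (forb R : ℕ) : Bool :=
  [0, 8, 16, 24].all (fun v => bit forb v || bit R v) && ([7, 15, 23, 31].all (fun v => !bit R v) &&
    vertexList.all fun v => !bit R v ||
      Nat.beq (Nat.lor R (Nat.lor (ladderNbrs v) forb)) (Nat.lor R forb))

/-- A sufficient criterion for there being no path from bottom to top outside `forb`: the set of
vertices reachable from the bottom, to which three rounds of `ladderGrow` suffice in the cases that
occur, is a certificate. The numbers `4294967295` and `16843009` are the bit masks of the set of all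
vertices and of the set of bottom vertices. -/
def ladderBlocked (forb : ℕ) : Bool :=
  let al := Nat.xor 4294967295 forb
  ladderSeparates forb (ladderGrow al (ladderGrow al (ladderGrow al (Nat.land 16843009 al))))

/-- Exhaustive search for the first of two non-adjacent paths: the path visited the vertices in
`vis` and is now at `v`, the closed neighbourhood of `vis` is `nbr`. The value is true only if no
continuation to the top leaves room for a second path. -/
def ladderSearch : ℕ → ℕ → ℕ → ℕ → Bool
  | 0, _, _, _ => false
  | fuel + 1, v, vis, nbr =>
    let forb := Nat.lor nbr (Nat.lor (ladderNbrs v) (Nat.shiftLeft 1 v))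
    let vis' := Nat.lor vis (Nat.shiftLeft 1 v)
    ladderBlocked forb || (!Nat.beq (Nat.mod v 8) 7 &&
      vertexList.all fun w => !bit (ladderNbrs v) w || (bit vis' w ||
        ladderSearch fuel w vis' forb))

lemma ladderSearch_eq_true : [0, 8, 16, 24].all (fun v => ladderSearch 15 v 0 0) = true := by
  decide +kernel

lemma bit_lor (m n i : ℕ) : bit (Nat.lor m n) i = (bit m i || bit n i) := by
  simp only [bit_eq_testBit]
  exact Nat.testBit_or m n i

lemma bit_shiftLeft (v i : ℕ) : bit (Nat.shiftLeft 1 v) i = decide (v = i) := by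
  rw [bit_eq_testBit]
  change (1 <<< v).testBit i = _
  rw [Nat.one_shiftLeft, Nat.testBit_two_pow]

lemma all_vertexList {f : ℕ → Bool} (h : vertexList.all f = true) (v : Fin 32) : f v = true :=
  List.all_eq_true.1 h _ (by
    rw [show vertexList = List.range 32 from rfl]
    exact List.mem_range.2 v.isLt)

lemma ladderBlocked_sound {forb : ℕ} (h : ladderBlocked forb = true) {x y : Fin 32}
    (q : ladderGraph.Walk x y) (hx : x ∈ ladderBottom) (hy : y ∈ ladderTop)
    (hq : ∀ z ∈ q.support, bit forb z = false) : False := by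
  obtain ⟨R, h⟩ : ∃ R, ladderSeparates forb R = true := ⟨_, h⟩
  simp only [ladderSeparates, Bool.and_eq_true] at h
  obtain ⟨h1, h2, h3⟩ := h
  have hcl : ∀ u v : Fin 32, bit R u = true → ladderGraph.Adj u v → bit forb v = false →
      bit R v = true := by
    intro u v hu huv hv
    have h4 := all_vertexList h3 u
    rw [hu, Bool.not_true, Bool.false_or, Nat.beq_eq] at h4
    have h5 := congrArg (bit · v) h4
    have h6 : bit (ladderNbrs u) v = true := huv
    simp only [bit_lor, h6, hv, Bool.or_true, Bool.or_false] at h5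
    exact h5.symm
  have hall : ∀ {u v : Fin 32} (q : ladderGraph.Walk u v), bit R u = true →
      (∀ z ∈ q.support, bit forb z = false) → bit R v = true := by
    intro u v q
    induction q with
    | nil => exact fun h _ => h
    | cons hadj q ih =>
      intro hu hq
      refine ih (hcl _ _ hu hadj (hq _ ?_)) fun z hz => hq z ?_
      · simp
      · simp [hz]
  have hbot : ∀ v : Fin 32, v.val % 8 = 0 → v.val ∈ [0, 8, 16, 24] := by decide
  have htop : ∀ v : Fin 32, v.val % 8 = 7 → v.val ∈ [7, 15, 23, 31] := by decide
  have hRx : bit R x = true := by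
    have h4 := List.all_eq_true.1 h1 _ (hbot x hx)
    rwa [hq x q.start_mem_support, Bool.false_or] at h4
  have h5 := List.all_eq_true.1 h2 _ (htop y hy)
  rw [hall q hRx hq] at h5
  exact absurd h5 (by simp)

lemma ladderSearch_sound (fuel : ℕ) {x y : Fin 32} (q : ladderGraph.Walk x y)
    (hx : x ∈ ladderBottom) (hy : y ∈ ladderTop) {v t : Fin 32} (vis nbr : ℕ)
    (h : ladderSearch fuel v vis nbr = true) (p : ladderGraph.Walk v t) (hp : p.IsPath)
    (ht : t ∈ ladderTop) (hpv : ∀ z ∈ p.support, bit vis z = false)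
    (hqn : ∀ z ∈ q.support, bit nbr z = false)
    (hpq : ∀ u ∈ p.support, ∀ z ∈ q.support, u ≠ z ∧ ¬ ladderGraph.Adj u z) : False := by
  induction fuel generalizing v vis nbr with
  | zero => simp [ladderSearch] at h
  | succ fuel ih =>
    have hforb : ∀ z ∈ q.support,
        bit (Nat.lor nbr (Nat.lor (ladderNbrs v) (Nat.shiftLeft 1 v))) z = false := by
      intro z hz
      obtain ⟨h1, h2⟩ := hpq v p.start_mem_support z hz
      have h3 : bit (ladderNbrs v) z = false := by
        rw [← Bool.not_eq_true]; exact h2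
      have h4 : (v : ℕ) ≠ z := fun h => h1 (Fin.ext h)
      rw [bit_lor, bit_lor, bit_shiftLeft, hqn z hz, h3]
      simp [h4]
    simp only [ladderSearch, Bool.or_eq_true (ladderBlocked _), Bool.and_eq_true] at h
    rcases h with h | ⟨htop, h⟩
    · exact ladderBlocked_sound h q hx hy hforb
    · cases p with
      | nil =>
        have ht' : t.val % 8 = 7 := ht
        change (!Nat.beq (t.val % 8) 7) = true at htop
        rw [ht'] at htop
        exact absurd htop (by decide)
      | @cons _ w _ hadj p =>
        rw [Walk.cons_isPath_iff] at hp
        have h1 := all_vertexList h w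
        have h2 : bit (ladderNbrs v) w = true := hadj
        have hw : ∀ z ∈ p.support, bit (Nat.lor vis (Nat.shiftLeft 1 v)) z = false := by
          intro z hz
          have h3 : (v : ℕ) ≠ z := fun h => hp.2 (Fin.ext h ▸ hz)
          rw [bit_lor, bit_shiftLeft, hpv z (by simp [hz])]
          simp [h3]
        rw [h2, Bool.not_true, Bool.false_or, hw w p.start_mem_support, Bool.false_or] at h1
        exact ih _ _ h1 p hp.1 hw hforb fun u hu => hpq u (by simp [hu])

theorem ladderGraph_not_nonAdjacent :
    ¬ ∃ P Q : ladderGraph.XYPath ladderBottom ladderTop, P.NonAdjacent Q := by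
  rintro ⟨P, Q, hdisj, hadj⟩
  have hbot : ∀ v : Fin 32, v.val % 8 = 0 → v.val ∈ [0, 8, 16, 24] := by decide
  have h := List.all_eq_true.1 ladderSearch_eq_true _ (hbot _ P.source_mem)
  exact ladderSearch_sound 15 Q.walk Q.source_mem Q.target_mem 0 0 h P.walk P.isPath P.target_mem
    (fun z _ => by simp [bit_eq_testBit]) (fun z _ => by simp [bit_eq_testBit])
    fun u hu z hz => ⟨fun e => Set.disjoint_left.1 hdisj hu (e ▸ hz), hadj u hu z hz⟩

/-! ### Maximum degree three does not suffice -/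

/-- The Petersen graph: the outer cycle is `0, 1, 2, 3, 4`, and vertex `i` of it is joined to vertex
`i + 5` of the inner cycle `5, 7, 9, 6, 8`. -/
def petersenGraph : SimpleGraph (Fin 10) :=
  SimpleGraph.fromRel fun u v => (u.val < 5 ∧ v.val = (u.val + 1) % 5) ∨ u.val + 5 = v.val ∨
    (5 ≤ u.val ∧ v.val = 5 + (u.val - 5 + 2) % 5)

instance : DecidableRel petersenGraph.Adj := by unfold petersenGraph; infer_instance

/-- The vertices of the outer cycle. -/
def petersenOuter : Set (Fin 10) := {v | v.val < 5}

/-- The vertices of the inner cycle. -/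
def petersenInner : Set (Fin 10) := {v | 5 ≤ v.val}

/-- The edge between the outer and the inner cycle at the outer vertex `i`. -/
def petersenSpoke (i : Fin 5) : petersenGraph.XYPath petersenOuter petersenInner where
  source := i.castAdd 5
  target := i.natAdd 5
  source_mem := i.isLt
  target_mem := Nat.le_add_right 5 i
  walk := .cons (by revert i; decide) .nil
  isPath := Walk.IsPath.of_adj (by revert i; decide)

lemma petersenSpoke_disjoint : XYPath.PairwiseDisjoint petersenSpoke := by
  intro i j hij
  rw [Set.disjoint_left]
  intro v hv hv'
  have h1 : v = i.castAdd 5 ∨ v = i.natAdd 5 := by simpa [petersenSpoke, XYPath.verts] using hv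
  have h2 : v = j.castAdd 5 ∨ v = j.natAdd 5 := by simpa [petersenSpoke, XYPath.verts] using hv'
  clear hv hv'
  revert i j v
  decide

lemma petersenGraph_maxDegree : petersenGraph.maxDegree = 3 := by decide +kernel

/-- Every path from the outer to the inner cycle contains both ends of some spoke. -/
lemma exists_spoke (P : petersenGraph.XYPath petersenOuter petersenInner) :
    ∃ i : Fin 5, i.castAdd 5 ∈ P.verts ∧ i.natAdd 5 ∈ P.verts := by
  obtain ⟨d, hd, h1, h2⟩ := P.walk.exists_boundary_dart petersenOuter P.source_mem
    (fun h => absurd (show P.target.val < 5 from h) (not_lt.2 P.target_mem))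
  have key : ∀ u v : Fin 10, petersenGraph.Adj u v → u.val < 5 → ¬ v.val < 5 →
      ∃ i : Fin 5, u = i.castAdd 5 ∧ v = i.natAdd 5 := by decide
  obtain ⟨i, hi, hi'⟩ := key _ _ d.adj h1 h2
  exact ⟨i, hi ▸ P.walk.dart_fst_mem_support_of_mem_darts hd,
    hi' ▸ P.walk.dart_snd_mem_support_of_mem_darts hd⟩

theorem petersenGraph_not_nonAdjacent :
    ¬ ∃ P Q : petersenGraph.XYPath petersenOuter petersenInner, P.NonAdjacent Q := by
  rintro ⟨P, Q, hdisj, hadj⟩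
  obtain ⟨i, hi, hi'⟩ := exists_spoke P
  obtain ⟨j, hj, hj'⟩ := exists_spoke Q
  have key : ∀ i j : Fin 5, i = j ∨ petersenGraph.Adj (i.castAdd 5) (j.castAdd 5) ∨
      petersenGraph.Adj (i.natAdd 5) (j.natAdd 5) := by decide
  rcases key i j with rfl | h | h
  · exact Set.disjoint_left.1 hdisj hi hj
  · exact hadj _ hi _ hj h
  · exact hadj _ hi' _ hj' h

end SimpleGraph

theorem mainTheorem4 :
    (∀ (V : Type*) (G : SimpleGraph V) (X Y : Set V) (𝓟 : Fin 5 → G.XYPath X Y),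
      SimpleGraph.XYPath.PairwiseDisjoint 𝓟 →
      SimpleGraph.XYPath.AtMostOneEdgeOff 𝓟 →
      ∃ P Q : G.XYPath X Y, P.NonAdjacent Q) ∧
    (∃ (n : ℕ) (G : SimpleGraph (Fin n)) (X Y : Set (Fin n)) (𝓟 : Fin 4 → G.XYPath X Y),
      SimpleGraph.XYPath.PairwiseDisjoint 𝓟 ∧
      SimpleGraph.XYPath.AtMostOneEdgeOff 𝓟 ∧
      ¬ ∃ P Q : G.XYPath X Y, P.NonAdjacent Q) ∧
    (∃ (n : ℕ) (G : SimpleGraph (Fin n)) (_ : DecidableRel G.Adj) (X Y : Set (Fin n))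
        (𝓟 : Fin 5 → G.XYPath X Y),
      SimpleGraph.XYPath.PairwiseDisjoint 𝓟 ∧
      G.maxDegree = 3 ∧
      ¬ ∃ P Q : G.XYPath X Y, P.NonAdjacent Q) := by
  refine ⟨fun V G X Y 𝓟 hd ho => SimpleGraph.exists_nonAdjacent_of_five 𝓟 hd ho,
    ⟨32, SimpleGraph.ladderGraph, _, _, SimpleGraph.ladderPath, SimpleGraph.ladderPath_disjoint,
      SimpleGraph.ladderPath_off, SimpleGraph.ladderGraph_not_nonAdjacent⟩,
    ⟨10, SimpleGraph.petersenGraph, inferInstance, _, _, SimpleGraph.petersenSpoke,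
      SimpleGraph.petersenSpoke_disjoint, SimpleGraph.petersenGraph_maxDegree,
      SimpleGraph.petersenGraph_not_nonAdjacent⟩⟩
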